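/- Let $S_n$ be the group of permutations of an $n$-element set. A triple $(\pi_1,\pi_2,\pi_3)\in S_n^3$ is said to invariably generate $S_n$ (respectively, invariably generate a transitive subgroup) if, whenever $\pi_i'$ is conjugate to $\pi_i$ in $S_n$ for $i=1,2,3$, the subgroup $\langle\pi_1',\pi_2',\pi_3'\rangle$ is equal to $S_n$ (respectively, is transitive). A permutation $\pi$ has a fixed set of size $k$ if there is a $k$-element set $S$ with $\pi(S)=S$. **Theorem.** Let $\pi_1,\pi_2,\pi_3\in S_n$ be chosen independently and uniformly at random. 1. The probability that $\pi_1,\pi_2,\pi_3$ invariably generate a transitive subgroup tends to $0$ as $n\to\infty$. In particular, the probability that they invariably generate $S_n$ tends to $0$ as $n\to\infty$. 2. Equivalently, with probability tending to $1$ as $n\to\infty$ there is an integer $k$ with $0<k<n$ such that $\pi_1,\pi_2,\pi_3$ each have a fixed set of size $k$. (The two statements are equivalent because, for every $n$ and all $\pi_1,\pi_2,\pi_3\in S_n$, such a $k$ exists if and only if $\pi_1,\pi_2,\pi_3$ do not invariably generate a transitive subgroup.) 3. More precisely, for every $\varepsilon>0$ there exist $k_0=k_0(\varepsilon)$ and $n_0=n_0(\varepsilon)$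 such that for every $n\ge n_0$, with probability at least $1-\varepsilon$, there is an integer $k$ with $0<k<n$ and $k\le k_0$ such that $\pi_1,\pi_2,\pi_3$ each have a fixed set of size $k$. -/

import Mathlib

open Filter Topology

/-- The probability of an event `E` under the uniform distribution on a finite nonempty set. -/
noncomputable def uniformProb {Ω : Type*} [Fintype Ω] [Nonempty Ω] (E : Set Ω) : ℝ :=
  ((PMF.uniformOfFintype Ω).toOuterMeasure E).toReal

theorem uniformProb_eq {Ω : Type*} [Fintype Ω] [Nonempty Ω] (E : Set Ω) :
    uniformProb E = (Nat.card E : ℝ) / (Nat.card Ω : ℝ) := by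
  classical
  rw [uniformProb, PMF.toOuterMeasure_uniformOfFintype_apply]
  simp [Nat.card_eq_fintype_card]

/-- A list `g₁, …, gᵣ` of group elements has a property `P` *invariably* if `g₁', …, gᵣ'` has `P`
whenever `gᵢ'` is conjugate to `gᵢ` for every `i`. -/
def Invariably {G : Type*} [Group G] {r : ℕ} (P : (Fin r → G) → Prop) (g : Fin r → G) : Prop :=
  ∀ g' : Fin r → G, (∀ i, IsConj (g i) (g' i)) → P g'

/-- The permutations `π₁, …, πᵣ` generate the full symmetric group `Sₙ`. -/
def GeneratesSym {n r : ℕ} (π : Fin r → Equiv.Perm (Fin n)) : Prop :=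
  Subgroup.closure (Set.range π) = ⊤

/-- The permutations `π₁, …, πᵣ` generate a transitive subgroup of `Sₙ`. -/
def GeneratesTransitive {n r : ℕ} (π : Fin r → Equiv.Perm (Fin n)) : Prop :=
  MulAction.IsPretransitive (Subgroup.closure (Set.range π)) (Fin n)

/-- `π` has a fixed set of size `k`: a `k`-element set `S` with `π(S) = S`. -/
def HasFixedSetOfSize {n : ℕ} (π : Equiv.Perm (Fin n)) (k : ℕ) : Prop :=
  ∃ S : Finset (Fin n), S.card = k ∧ S.image π = S

/-! A union of cycles is invariant, so every subset sum of the cycle lengths of a permutation is the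
size of a fixed set. Fixed sets of equal size can be made to coincide by conjugating, and then the
three permutations generate an intransitive group (`not_invariably_generatesTransitive_iff`). So the
task is to find a common, bounded, positive subset sum of three random collections of cycle lengths.

For fixed `N` the numbers of cycles of lengths `1, …, N` converge jointly to independent Poisson
variables of means `1 / j` (`tendsto_uniformProb_count_eq`). This reduces everything to three
independent Poisson families (`exists_measure_hasCommonSubsum_gt`). There it suffices that, for some
fixed `δ > 0` and every `Q`, some block of lengths beyond `2 ^ Q` yields a common subset sum with
probability at least `δ` (`exists_measure_hasCommonSubsum_ge`): disjoint blocks are independent, so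
`m` successive blocks all fail with probability at most `(1 - δ) ^ m`.

For one block put `M = 2 ^ R`. With probability at least `1 / 2` the pairs `(s₀ - s₂, s₁ - s₂)` of
differences of subset sums from `(2 ^ Q, M]` fill a positive proportion of `(ℤ / M)²`. By
Cauchy–Schwarz and Parseval this follows from a bound on a sum over frequencies `a, b` of products
of factors `cos²`. At a frequency at distance about `2 ^ e` from `0`, write `cos² = ½ · 2cos²` for
the lengths beyond `2 ^ (R - e)`. The factors `2cos²` contribute a bounded expectation. The halves
contribute `2` to the power minus the number of such lengths, which is typically near `e log 2`; the
mean of this power is much larger, of order `2 ^ (-e / 2)`, so families with too few lengths must be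
excluded (`sparsity`). The double sum is then controlled by the square of a sum of `2 ^ (-(3/2) e
log 2)` over frequencies, bounded because `(3/2) log 2 > 1`.

Finally, a dense set of differences gives at least a constant times `M ^ 3` triples of longer
lengths, each completing three subset sums to a common value (`exists_completing_triples`). Each
triple occurs, disjointly and independently of the shorter lengths, with probability at least a
constant times `M ^ (-3)` (`measure_exists_mem_le`). -/

/-! ### Invariant sets as unions of cycles -/

theorem Multiset.exists_le_map_eq_of_le_map {α β : Type*} {f : α → β} {s : Multiset α}
    {t : Multiset β} (h : t ≤ s.map f) : ∃ u ≤ s, u.map f = t := by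
  induction s using Quotient.inductionOn with | _ s =>
  induction t using Quotient.inductionOn with | _ t =>
  obtain ⟨l, hl, hls⟩ := (Multiset.coe_le (l₁ := t) (l₂ := s.map f)).1 h
  obtain ⟨l', hl', rfl⟩ := List.sublist_map_iff.1 hls
  exact ⟨l', Multiset.coe_le.2 hl'.subperm, Multiset.coe_eq_coe.2 hl⟩

/-- The blocks are the supports of the nontrivial cycles together with the singletons of the fixed
points. -/
theorem Equiv.Perm.exists_invariant_blocks {α : Type*} [Fintype α] [DecidableEq α]
    (π : Equiv.Perm α) :
    ∃ B : Finset (Finset α), B.val.map Finset.card = π.partition.parts ∧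
      (B : Set (Finset α)).PairwiseDisjoint id ∧ ∀ S ∈ B, S.image π = S := by
  -- Injectivity keeps the multiplicities of cycle lengths intact when passing to a `Finset` of
  -- supports.
  have hsupp : Set.InjOn Equiv.Perm.support (π.cycleFactorsFinset : Set (Equiv.Perm α)) := by
    intro c hc d hd hcd
    by_contra hne
    have h1 := (π.cycleFactorsFinset_pairwise_disjoint hc hd hne).disjoint_support
    rw [← hcd, disjoint_self] at h1
    exact (Equiv.Perm.mem_cycleFactorsFinset_iff.1 hc).1.ne_one
      (Equiv.Perm.support_eq_empty_iff.1 h1)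
  have hcd : _root_.Disjoint (π.cycleFactorsFinset.image Equiv.Perm.support)
      (π.supportᶜ.image fun x => ({x} : Finset α)) := by
    rw [Finset.disjoint_left]
    rintro S hS hS'
    obtain ⟨c, hc, rfl⟩ := Finset.mem_image.1 hS
    obtain ⟨x, hx, hxc⟩ := Finset.mem_image.1 hS'
    refine Finset.mem_compl.1 hx (Equiv.Perm.mem_cycleFactorsFinset_support_le hc ?_)
    rw [← hxc]; exact Finset.mem_singleton_self x
  refine ⟨(π.cycleFactorsFinset.image Equiv.Perm.support).disjUnion
    (π.supportᶜ.image fun x => ({x} : Finset α)) hcd, ?_, ?_, ?_⟩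
  · rw [Equiv.Perm.parts_partition, Finset.disjUnion_val, Multiset.map_add,
      Finset.image_val_of_injOn hsupp,
      Finset.image_val_of_injOn (fun _ _ _ _ h => Finset.singleton_injective h),
      Equiv.Perm.cycleType_def]
    simp [Finset.card_compl]
  · intro S hS T hT hne
    simp only [Finset.coe_disjUnion, Set.mem_union, Finset.mem_coe] at hS hT
    rw [Function.onFun, id, id]
    have key : ∀ c ∈ π.cycleFactorsFinset, ∀ x ∈ π.supportᶜ, _root_.Disjoint c.support {x} := by
      intro c hc x hx
      rw [Finset.disjoint_singleton_right]
      exact fun h => Finset.mem_compl.1 hx (Equiv.Perm.mem_cycleFactorsFinset_support_le hc h)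
    rcases hS with hS | hS <;> rcases hT with hT | hT <;>
      obtain ⟨c, hc, rfl⟩ := Finset.mem_image.1 hS <;>
      obtain ⟨d, hd, rfl⟩ := Finset.mem_image.1 hT
    · exact (π.cycleFactorsFinset_pairwise_disjoint hc hd (fun h => hne (h ▸ rfl))).disjoint_support
    · exact key c hc d hd
    · exact (key d hd c hc).symm
    · rw [Finset.disjoint_singleton]
      exact fun h => hne (h ▸ rfl)
  · intro S hS
    apply Finset.eq_of_subset_of_card_le _ (by rw [Finset.card_image_of_injective _ π.injective])
    rcases Finset.mem_disjUnion.1 hS with hS | hS <;> obtain ⟨c, hc, rfl⟩ := Finset.mem_image.1 hS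
    · intro y hy
      obtain ⟨x, hx, rfl⟩ := Finset.mem_image.1 hy
      rw [← (Equiv.Perm.mem_cycleFactorsFinset_iff.1 hc).2 x hx]
      exact Equiv.Perm.apply_mem_support.2 hx
    · simpa using hc

theorem Equiv.Perm.exists_invariant_card_eq_sum {α : Type*} [Fintype α] [DecidableEq α]
    (π : Equiv.Perm α) {T : Multiset ℕ} (hT : T ≤ π.partition.parts) :
    ∃ S : Finset α, S.card = T.sum ∧ S.image π = S := by
  obtain ⟨B, hB, hdisj, hinv⟩ := π.exists_invariant_blocks
  rw [← hB] at hT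
  obtain ⟨t, ht, rfl⟩ := Multiset.exists_le_map_eq_of_le_map hT
  have htn : t.Nodup := Multiset.nodup_of_le ht B.nodup
  have htB : ∀ S ∈ t, S ∈ B := fun S hS => Multiset.mem_of_le ht hS
  refine ⟨(Finset.mk t htn).biUnion id, ?_, ?_⟩
  · rw [Finset.card_biUnion]
    · rfl
    · exact fun x hx y hy hxy => hdisj (htB x hx) (htB y hy) hxy
  · rw [Finset.biUnion_image]
    exact Finset.biUnion_congr rfl fun S hS => hinv S (htB S hS)

/-! ### Fixed sets, conjugation and transitivity -/

theorem HasFixedSetOfSize.of_isConj {n k : ℕ} {π ρ : Equiv.Perm (Fin n)} (h : IsConj π ρ)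
    (hπ : HasFixedSetOfSize π k) : HasFixedSetOfSize ρ k := by
  obtain ⟨c, rfl⟩ := isConj_iff.1 h
  obtain ⟨S, hS, hS'⟩ := hπ
  refine ⟨S.image c, by rw [Finset.card_image_of_injective _ c.injective, hS], ?_⟩
  conv_rhs => rw [← hS']
  simp only [Finset.image_image]
  congr 1
  ext x
  simp

/-- Conjugation by any permutation carrying `S` onto `T` works. -/
theorem exists_isConj_image_eq {n : ℕ} {π : Equiv.Perm (Fin n)} {S T : Finset (Fin n)}
    (hS : S.image π = S) (h : S.card = T.card) :
    ∃ ρ : Equiv.Perm (Fin n), IsConj π ρ ∧ T.image ρ = T := by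
  classical
  have e : {x // x ∈ S} ≃ {x // x ∈ T} := Fintype.equivOfCardEq (by simpa using h)
  refine ⟨e.extendSubtype * π * (e.extendSubtype)⁻¹, isConj_iff.2 ⟨_, rfl⟩, ?_⟩
  have hT : T = S.image e.extendSubtype := by
    symm
    apply Finset.eq_of_subset_of_card_le
    · intro x hx
      obtain ⟨y, hy, rfl⟩ := Finset.mem_image.1 hx
      exact e.extendSubtype_mem y hy
    · rw [Finset.card_image_of_injective _ (Equiv.injective _), h]
  generalize e.extendSubtype = f at hT
  rw [hT]
  conv_rhs => rw [← hS]
  simp only [Finset.image_image]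
  congr 1
  ext x
  simp

theorem not_generatesTransitive_of_image_eq {n r : ℕ} {ρ : Fin r → Equiv.Perm (Fin n)}
    {T : Finset (Fin n)} (h0 : 0 < T.card) (hn : T.card < n) (hT : ∀ i, T.image (ρ i) = T) :
    ¬ GeneratesTransitive ρ := by
  intro htr
  obtain ⟨x, hx⟩ := Finset.card_pos.1 h0
  obtain ⟨y, hy⟩ : ∃ y, y ∉ T := by
    by_contra! hall
    have : T = Finset.univ := Finset.eq_univ_iff_forall.2 hall
    simp [this] at hn
  obtain ⟨g, hg⟩ := htr.exists_smul_eq x y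
  have key : ∀ g ∈ Subgroup.closure (Set.range ρ), T.image g = T := by
    intro g hg
    induction hg using Subgroup.closure_induction with
    | mem x hx => obtain ⟨i, rfl⟩ := hx; exact hT i
    | one => simp
    | mul a b _ _ ha hb =>
      rw [Equiv.Perm.coe_mul, ← Finset.image_image, hb, ha]
    | inv a _ ha =>
      conv_lhs => rw [← ha]
      rw [Finset.image_image]
      have : (⇑a⁻¹ ∘ ⇑a) = id := by ext x; simp
      rw [this, Finset.image_id]
  apply hy
  rw [← key g g.2, ← hg]
  exact Finset.mem_image_of_mem _ hx

theorem exists_invariant_of_not_generatesTransitive {n r : ℕ} {ρ : Fin r → Equiv.Perm (Fin n)}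
    (h : ¬ GeneratesTransitive ρ) :
    ∃ T : Finset (Fin n), 0 < T.card ∧ T.card < n ∧ ∀ i, T.image (ρ i) = T := by
  classical
  have h' : ∃ x y : Fin n, ∀ g ∈ Subgroup.closure (Set.range ρ), g x ≠ y := by
    by_contra! hall
    exact h ⟨fun x y => by
      obtain ⟨g, hg, hxy⟩ := hall x y
      exact ⟨⟨g, hg⟩, hxy⟩⟩
  obtain ⟨x, y, hxy⟩ := h'
  -- The orbit of `x`, which misses `y`.
  refine ⟨Finset.univ.filter fun z => ∃ g ∈ Subgroup.closure (Set.range ρ), g x = z,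
    ?_, ?_, ?_⟩
  · exact Finset.card_pos.2 ⟨x, by simpa using ⟨1, Subgroup.one_mem _, rfl⟩⟩
  · calc _ < (Finset.univ : Finset (Fin n)).card := by
          apply Finset.card_lt_card
          rw [Finset.ssubset_univ_iff]
          intro hu
          have := Finset.mem_univ y
          rw [← hu] at this
          obtain ⟨g, hg, hgy⟩ := (Finset.mem_filter.1 this).2
          exact hxy g hg hgy
      _ = n := by simp
  · intro i
    apply Finset.eq_of_subset_of_card_le
    · intro z hz
      obtain ⟨w, hw, rfl⟩ := Finset.mem_image.1 hz
      obtain ⟨g, hg, hgw⟩ := (Finset.mem_filter.1 hw).2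
      refine Finset.mem_filter.2 ⟨Finset.mem_univ _, ρ i * g,
        Subgroup.mul_mem _ (Subgroup.subset_closure ⟨i, rfl⟩) hg, ?_⟩
      rw [← hgw]; rfl
    · rw [Finset.card_image_of_injective _ (Equiv.injective _)]

/-- An orbit of an intransitive group is a common invariant set, and its size survives conjugating
back. Conversely, invariant sets of equal size can all be conjugated onto one prescribed set. -/
theorem not_invariably_generatesTransitive_iff {n r : ℕ} (π : Fin r → Equiv.Perm (Fin n)) :
    ¬ Invariably GeneratesTransitive π ↔
      ∃ k : ℕ, 0 < k ∧ k < n ∧ ∀ i, HasFixedSetOfSize (π i) k := by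
  constructor
  · intro h
    simp only [Invariably, not_forall] at h
    obtain ⟨ρ, hρ, hn⟩ := h
    obtain ⟨T, h0, h1, hT⟩ := exists_invariant_of_not_generatesTransitive hn
    exact ⟨T.card, h0, h1, fun i => HasFixedSetOfSize.of_isConj (hρ i).symm ⟨T, rfl, hT i⟩⟩
  · rintro ⟨k, h0, h1, h⟩ hinv
    obtain ⟨T, -, hT⟩ := Finset.exists_subset_card_eq
      (show k ≤ (Finset.univ : Finset (Fin n)).card by simpa using h1.le)
    have : ∀ i, ∃ ρ, IsConj (π i) ρ ∧ T.image ρ = T := fun i => by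
      obtain ⟨S, hS, hS'⟩ := h i
      exact exists_isConj_image_eq hS' (hS.trans hT.symm)
    choose ρ hρ hρ' using this
    exact not_generatesTransitive_of_image_eq (by omega) (by omega) hρ' (hinv ρ hρ)

theorem GeneratesSym.generatesTransitive {n r : ℕ} {π : Fin r → Equiv.Perm (Fin n)}
    (h : GeneratesSym π) : GeneratesTransitive π := by
  refine ⟨fun x y => ⟨⟨Equiv.swap x y, ?_⟩, Equiv.swap_apply_left x y⟩⟩
  rw [GeneratesSym] at h
  rw [h]
  trivial

theorem Invariably.mono {G : Type*} [Group G] {r : ℕ} {P Q : (Fin r → G) → Prop}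
    (hPQ : ∀ g, P g → Q g) {g : Fin r → G} (h : Invariably P g) : Invariably Q g :=
  fun g' hg' => hPQ g' (h g' hg')

/-! ### Elementary properties of the uniform probability -/

section uniformProb

variable {Ω : Type*} [Fintype Ω] [Nonempty Ω]

theorem uniformProb_nonneg (E : Set Ω) : 0 ≤ uniformProb E := ENNReal.toReal_nonneg

theorem uniformProb_mono {E F : Set Ω} (h : E ⊆ F) : uniformProb E ≤ uniformProb F := by
  rw [uniformProb_eq, uniformProb_eq]
  have : Nat.card E ≤ Nat.card F := Nat.card_mono (Set.toFinite F) h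
  gcongr

theorem uniformProb_compl (E : Set Ω) : uniformProb Eᶜ = 1 - uniformProb E := by
  classical
  have h : Nat.card E + Nat.card ↑Eᶜ = Nat.card Ω := by
    exact Set.ncard_add_ncard_compl E
  have h0 : (Nat.card Ω : ℝ) ≠ 0 := by
    exact_mod_cast Nat.card_pos.ne'
  rw [uniformProb_eq, uniformProb_eq, ← h, eq_sub_iff_add_eq, ← add_div, div_eq_one_iff_eq]
  · push_cast; ring
  · rwa [h]

theorem uniformProb_le_one (E : Set Ω) : uniformProb E ≤ 1 := by
  have := uniformProb_nonneg Eᶜ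
  rw [uniformProb_compl] at this
  linarith

theorem sum_uniformProb_le_of_pairwiseDisjoint {ι : Type*} {s : Finset ι} {E : ι → Set Ω}
    {F : Set Ω} (hE : (s : Set ι).PairwiseDisjoint E) (hF : ∀ i ∈ s, E i ⊆ F) :
    ∑ i ∈ s, uniformProb (E i) ≤ uniformProb F := by
  classical
  simp only [uniformProb_eq, ← Finset.sum_div]
  gcongr
  norm_cast
  simp only [Nat.card_eq_card_toFinset]
  rw [← Finset.card_biUnion]
  · apply Finset.card_le_card
    intro x hx
    obtain ⟨i, hi, hx⟩ := Finset.mem_biUnion.1 hx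
    exact Set.mem_toFinset.2 (hF i hi (Set.mem_toFinset.1 hx))
  · intro i hi j hj hij
    exact Set.disjoint_toFinset.2 (hE hi hj hij)

theorem uniformProb_pi {ι : Type*} [Fintype ι] [DecidableEq ι] (E : ι → Set Ω) :
    uniformProb {x : ι → Ω | ∀ i, x i ∈ E i} = ∏ i, uniformProb (E i) := by
  classical
  simp only [uniformProb_eq, Finset.prod_div_distrib]
  congr 1
  · have : {x : ι → Ω | ∀ i, x i ∈ E i} = Set.univ.pi E := by ext; simp
    rw [this, Nat.card_congr (Equiv.Set.univPi E), Nat.card_pi]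
    push_cast; rfl
  · rw [Nat.card_pi]; push_cast; rfl
end uniformProb

/-! ### Cycle types of random permutations and their Poisson limit -/

/-- The weight `1 / (i ^ c * c!)` of `c` cycles of length `i`. -/
noncomputable def cycleWeight (i c : ℕ) : ℝ := ((i : ℝ) ^ c * c.factorial)⁻¹

/-- The proportion of permutations whose multiset of cycle lengths is `s`. -/
noncomputable def partWeight (s : Multiset ℕ) : ℝ := ∏ i ∈ s.toFinset, cycleWeight i (s.count i)

@[simp] theorem cycleWeight_zero (i : ℕ) : cycleWeight i 0 = 1 := by simp [cycleWeight]

theorem cycleWeight_nonneg (i c : ℕ) : 0 ≤ cycleWeight i c := by unfold cycleWeight; positivity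

theorem partWeight_nonneg (s : Multiset ℕ) : 0 ≤ partWeight s :=
  Finset.prod_nonneg fun _ _ => cycleWeight_nonneg _ _

theorem partWeight_eq_prod {s : Multiset ℕ} {A : Finset ℕ} (h : s.toFinset ⊆ A) :
    partWeight s = ∏ i ∈ A, cycleWeight i (s.count i) := by
  refine Finset.prod_subset h fun i _ hi => ?_
  rw [Multiset.count_eq_zero.2 (by simpa using hi), cycleWeight_zero]

theorem partWeight_add {s t : Multiset ℕ} (h : Disjoint s t) :
    partWeight (s + t) = partWeight s * partWeight t := by
  have h' : Disjoint s.toFinset t.toFinset := by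
    rw [Finset.disjoint_left]
    intro i hi hj
    exact Multiset.disjoint_left.1 h (by simpa using hi) (by simpa using hj)
  rw [partWeight, Multiset.toFinset_add, Finset.prod_union h']
  congr 1
  · refine Finset.prod_congr rfl fun i hi => ?_
    rw [Multiset.count_add, Multiset.count_eq_zero.2 (Multiset.disjoint_left.1 h (by simpa using hi)),
      add_zero]
  · refine Finset.prod_congr rfl fun i hi => ?_
    rw [Multiset.count_add, Multiset.count_eq_zero.2 (Multiset.disjoint_right.1 h (by simpa using hi)),
      zero_add]

theorem partWeight_replicate (l i : ℕ) : partWeight (Multiset.replicate l i) = cycleWeight i l := by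
  rw [partWeight_eq_prod (A := {i})]
  · simp
  · intro j hj
    simpa using Multiset.eq_of_mem_replicate (Multiset.mem_toFinset.1 hj)

theorem partWeight_eq_inv (s : Multiset ℕ) :
    partWeight s = ((s.prod : ℝ) * ∏ i ∈ s.toFinset, ((s.count i).factorial : ℝ))⁻¹ := by
  rw [Finset.prod_multiset_count s]
  push_cast
  rw [← Finset.prod_mul_distrib, ← Finset.prod_inv_distrib]
  rfl

theorem Nat.Partition.parts_eq_filter_add_replicate {n : ℕ} (p : n.Partition) :
    p.parts = p.parts.filter (2 ≤ ·) + Multiset.replicate (p.parts.count 1) 1 := by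
  conv_lhs => rw [← Multiset.filter_add_not (2 ≤ ·) p.parts]
  congr 1
  rw [← Multiset.filter_eq' p.parts 1]
  refine Multiset.filter_congr fun i hi => ?_
  have := p.parts_pos hi
  omega

theorem Equiv.Perm.parts_partition_eq_iff {n : ℕ} (π : Equiv.Perm (Fin n)) (p : n.Partition) :
    π.partition.parts = p.parts ↔ π.cycleType = p.parts.filter (2 ≤ ·) := by
  constructor
  · intro h
    rw [← h, Equiv.Perm.filter_parts_partition_eq_cycleType]
  · intro h
    have hp := p.parts_eq_filter_add_replicate
    have hs := π.partition.parts_sum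
    have hs' := p.parts_sum
    rw [Equiv.Perm.parts_partition] at hs ⊢
    rw [hp] at hs' ⊢
    rw [h] at hs ⊢
    simp only [Multiset.sum_add, Multiset.sum_replicate, smul_eq_mul, mul_one] at hs hs'
    simp only [Fintype.card_fin] at hs
    congr 2
    rw [Fintype.card_fin]
    omega

/-- Cauchy's formula for the size of a conjugacy class. `cycleType` omits fixed points, so the parts
equal to `1` are split off; they contribute the factorial of their number. -/
theorem uniformProb_partition {n : ℕ} (p : n.Partition) :
    uniformProb {π : Equiv.Perm (Fin n) | π.partition.parts = p.parts} = partWeight p.parts := by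
  classical
  have hp := p.parts_eq_filter_add_replicate
  have hs := p.parts_sum
  rw [hp] at hs
  simp only [Multiset.sum_add, Multiset.sum_replicate, smul_eq_mul, mul_one] at hs
  simp only [Equiv.Perm.parts_partition_eq_iff]
  have hc := Equiv.Perm.card_of_cycleType_mul_eq (Fin n) (p.parts.filter (2 ≤ ·))
  rw [if_pos ⟨by simp; omega, fun a ha => (Multiset.mem_filter.1 ha).2⟩] at hc
  simp only [Fintype.card_fin] at hc
  rw [show n - (p.parts.filter (2 ≤ ·)).sum = p.parts.count 1 by omega] at hc
  conv_rhs => rw [hp]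
  have hR : (Nat.card {π : Equiv.Perm (Fin n) | π.cycleType = p.parts.filter (2 ≤ ·)} : ℝ) *
      (((p.parts.filter (2 ≤ ·)).prod * ∏ i ∈ (p.parts.filter (2 ≤ ·)).toFinset,
        (((p.parts.filter (2 ≤ ·)).count i).factorial : ℝ)) * (p.parts.count 1).factorial) =
      n.factorial := by
    rw [← hc, Nat.card_eq_card_toFinset, Set.toFinset_ofPred]
    push_cast
    ring
  have hn : (n.factorial : ℝ) ≠ 0 := by positivity
  have hB := right_ne_zero_of_mul (hR.trans_ne hn)
  rw [partWeight_add, partWeight_replicate, partWeight_eq_inv, cycleWeight, uniformProb_eq,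
    Nat.card_eq_fintype_card (α := Equiv.Perm (Fin n)), Fintype.card_perm, Fintype.card_fin,
    ← mul_inv, Nat.cast_one, one_pow, one_mul, div_eq_iff hn, eq_comm, inv_mul_eq_iff_eq_mul₀ hB,
    ← hR, mul_comm]
  · rw [Multiset.disjoint_right]
    intro a ha
    rw [Multiset.eq_of_mem_replicate ha]
    simp

/-- The proportion of permutations of `n` points all of whose cycles are longer than `N`. -/
noncomputable def longCycleProb (N n : ℕ) : ℝ :=
  ∑ p : n.Partition with ∀ i ∈ p.parts, N < i, partWeight p.parts

/-- Prescribing the parts in `U` leaves a free partition of the remainder into parts in `V`, and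
weights multiply over disjoint sets of part sizes. -/
theorem sum_partWeight_filter_eq {U V : ℕ → Prop} [DecidablePred U] [DecidablePred V]
    (hUV : ∀ i, U i → ¬ V i) {s : Multiset ℕ} (hs : ∀ i ∈ s, U i ∧ 0 < i) (n : ℕ) :
    ∑ p : (n + s.sum).Partition with (∀ i ∈ p.parts, U i ∨ V i) ∧ p.parts.filter U = s,
      partWeight p.parts =
    partWeight s * ∑ p : n.Partition with ∀ i ∈ p.parts, V i, partWeight p.parts := by
  rw [Finset.mul_sum]
  symm
  refine Finset.sum_bij (fun p _ => ⟨p.parts + s, ?_, ?_⟩) ?_ ?_ ?_ ?_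
  · intro i hi
    rcases Multiset.mem_add.1 hi with h | h
    · exact p.parts_pos h
    · exact (hs i h).2
  · rw [Multiset.sum_add, p.parts_sum]
  · intro p hp
    have hV := (Finset.mem_filter.1 hp).2
    simp only [Finset.mem_filter, Finset.mem_univ, true_and]
    constructor
    · intro i hi
      rcases Multiset.mem_add.1 hi with h | h
      · exact Or.inr (hV i h)
      · exact Or.inl (hs i h).1
    · rw [Multiset.filter_add, Multiset.filter_eq_nil.2 fun a ha hU => hUV a hU (hV a ha),
        Multiset.filter_eq_self.2 fun a ha => (hs a ha).1, zero_add]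
  · intro p _ q _ h
    simpa [Nat.Partition.ext_iff] using h
  · intro q hq
    obtain ⟨h1, h2⟩ := (Finset.mem_filter.1 hq).2
    have hq' : q.parts.filter (fun i => ¬ U i) + s = q.parts := by
      refine Eq.trans ?_ (Multiset.filter_add_not U q.parts)
      rw [h2, add_comm]
    refine ⟨⟨q.parts.filter (fun i => ¬ U i), fun hi => q.parts_pos (Multiset.mem_filter.1 hi).1, ?_⟩,
      ?_, ?_⟩
    · have := q.parts_sum
      rw [← hq', Multiset.sum_add] at this
      omega
    · simp only [Finset.mem_filter, Finset.mem_univ, true_and, Multiset.mem_filter]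
      exact fun i hi => (h1 i hi.1).resolve_left hi.2
    · exact Nat.Partition.ext hq'
  · intro p hp
    have hV := (Finset.mem_filter.1 hp).2
    rw [partWeight_add, mul_comm]
    rw [Multiset.disjoint_left]
    intro a ha ha'
    exact hUV a (hs a ha').1 (hV a ha)

theorem uniformProb_eq_sum_partWeight {n : ℕ} (Q : Multiset ℕ → Prop) [DecidablePred Q] :
    uniformProb {π : Equiv.Perm (Fin n) | Q π.partition.parts} =
      ∑ p : n.Partition with Q p.parts, partWeight p.parts := by
  classical
  simp only [← uniformProb_partition, uniformProb_eq, ← Finset.sum_div]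
  congr 1
  norm_cast
  simp only [Nat.card_eq_card_toFinset, Set.toFinset_ofPred]
  -- `π.partition` is a partition of `Fintype.card (Fin n)`; it is repackaged as one of `n`.
  let f : Equiv.Perm (Fin n) → n.Partition := fun π =>
    ⟨π.partition.parts, π.partition.parts_pos, by simpa using π.partition.parts_sum⟩
  rw [Finset.card_eq_sum_card_fiberwise (f := f) (t := Finset.univ.filter fun p => Q p.parts)]
  · refine Finset.sum_congr rfl fun p hp => ?_
    congr 1
    ext π
    simp only [Finset.mem_filter, Finset.mem_univ, true_and, f, Nat.Partition.ext_iff]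
    exact ⟨fun h => h.2, fun h => ⟨h ▸ (Finset.mem_filter.1 hp).2, h⟩⟩
  · intro π hπ
    simpa [f] using hπ

theorem longCycleProb_zero (n : ℕ) : longCycleProb 0 n = 1 := by
  have h := uniformProb_eq_sum_partWeight (n := n) (fun t => ∀ i ∈ t, 0 < i)
  rw [longCycleProb, ← h]
  have : {π : Equiv.Perm (Fin n) | ∀ i ∈ π.partition.parts, 0 < i} = Set.univ :=
    Set.eq_univ_of_forall fun π i hi => π.partition.parts_pos hi
  rw [this, uniformProb_eq, Nat.card_univ, div_self]
  exact_mod_cast Nat.card_pos.ne'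

theorem longCycleProb_nonneg (N n : ℕ) : 0 ≤ longCycleProb N n :=
  Finset.sum_nonneg fun _ _ => partWeight_nonneg _

theorem longCycleProb_le_one (N n : ℕ) : longCycleProb N n ≤ 1 := by
  rw [← longCycleProb_zero n]
  refine Finset.sum_le_sum_of_subset_of_nonneg ?_ fun _ _ _ => partWeight_nonneg _
  intro p hp
  simp only [Finset.mem_filter, Finset.mem_univ, true_and] at hp ⊢
  exact fun i hi => (Nat.zero_le _).trans_lt (hp i hi)

/-- Classify by the number `l` of cycles of length `N + 1`. The condition in the summand guards
against truncated subtraction. -/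
theorem longCycleProb_eq_sum (N n : ℕ) :
    longCycleProb N n = ∑ l ∈ Finset.range (n + 1),
      cycleWeight (N + 1) l * if l * (N + 1) ≤ n then longCycleProb (N + 1) (n - l * (N + 1)) else 0 := by
  classical
  rw [longCycleProb, ← Finset.sum_fiberwise_of_maps_to (g := fun p => p.parts.count (N + 1))
    (t := Finset.range (n + 1))]
  · refine Finset.sum_congr rfl fun l _ => ?_
    split_ifs with h
    · obtain ⟨m, rfl⟩ : ∃ m, n = m + (Multiset.replicate l (N + 1)).sum :=
        ⟨n - l * (N + 1), by simp; omega⟩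
      have := sum_partWeight_filter_eq (U := (· = N + 1)) (V := (N + 1 < ·)) (fun i h h' => by omega)
        (s := Multiset.replicate l (N + 1))
        (fun i hi => ⟨Multiset.eq_of_mem_replicate hi, by rw [Multiset.eq_of_mem_replicate hi]; omega⟩) m
      rw [partWeight_replicate] at this
      rw [show m + (Multiset.replicate l (N + 1)).sum - l * (N + 1) = m by simp, longCycleProb, ← this,
        Finset.filter_filter]
      congr 1
      ext p
      simp only [Finset.mem_filter, Finset.mem_univ, true_and, Multiset.filter_eq']
      refine and_congr (forall₂_congr fun i _ => by omega) ?_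
      exact ⟨fun h => by rw [h], fun h => by simpa using congrArg Multiset.card h⟩
    · rw [mul_zero]
      refine Finset.sum_eq_zero fun p hp => absurd ?_ h
      rw [← (Finset.mem_filter.1 hp).2]
      have h1 : Multiset.replicate (p.parts.count (N + 1)) (N + 1) ≤ p.parts :=
        Multiset.le_count_iff_replicate_le.1 le_rfl
      obtain ⟨u, hu⟩ := Multiset.le_iff_exists_add.1 h1
      have h2 := congrArg Multiset.sum hu
      rw [p.parts_sum, Multiset.sum_add, Multiset.sum_replicate, smul_eq_mul] at h2
      omega
  · intro p _
    rw [Finset.mem_range, Nat.lt_succ_iff]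
    refine (Multiset.count_le_card _ _).trans ?_
    calc p.parts.card ≤ p.parts.sum := by
          have := Multiset.card_nsmul_le_sum (s := p.parts) (a := 1) fun x hx => p.parts_pos hx
          simpa using this
      _ = n := p.parts_sum

/-- The power series `exp (x / k)` and `exp (-x / k)` are inverse to each other; here this is the
alternating binomial sum. -/
theorem sum_alternating_cycleWeight (k r : ℕ) :
    ∑ m ∈ Finset.range (r + 1), (-1) ^ m * cycleWeight k m * cycleWeight k (r - m) =
      if r = 0 then 1 else 0 := by
  have h := Int.alternating_sum_range_choose (n := r)
  have h' : ∑ m ∈ Finset.range (r + 1), (-1 : ℝ) ^ m * (r.choose m) = if r = 0 then 1 else 0 := by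
    exact_mod_cast h
  have : ∀ m ∈ Finset.range (r + 1), (-1 : ℝ) ^ m * cycleWeight k m * cycleWeight k (r - m) =
      ((-1) ^ m * (r.choose m)) * cycleWeight k r := by
    intro m hm
    have hm : m ≤ r := by simpa [Nat.lt_succ_iff] using hm
    rw [Nat.cast_choose ℝ hm, cycleWeight, cycleWeight, cycleWeight]
    have hp : (k : ℝ) ^ r = k ^ m * k ^ (r - m) := by rw [← pow_add]; congr 1; omega
    rw [hp, mul_assoc, mul_assoc, ← mul_inv]
    congr 1
    have : (r.factorial : ℝ) ≠ 0 := by positivity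
    rw [div_eq_inv_mul, mul_inv _ (r.factorial : ℝ),
      mul_mul_mul_comm _ (r.factorial : ℝ), mul_inv_cancel₀ this,
      mul_one, ← mul_inv]
    congr 1; ring
  rw [Finset.sum_congr rfl this, ← Finset.sum_mul, h']
  split_ifs with hr
  · simp [hr]
  · simp

/-- The recursion in `longCycleProb_eq_sum` is a convolution with the coefficients of `exp (x / (N +
1))`. Convolving with those of `exp (-x / (N + 1))` inverts it, which makes induction on `N`
possible. -/
theorem longCycleProb_succ_eq_sum (N n : ℕ) :
    longCycleProb (N + 1) n = ∑ m ∈ Finset.range (n + 1), (-1) ^ m * cycleWeight (N + 1) m *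
      if m * (N + 1) ≤ n then longCycleProb N (n - m * (N + 1)) else 0 := by
  set b : ℕ → ℝ := fun r => if r * (N + 1) ≤ n then longCycleProb (N + 1) (n - r * (N + 1)) else 0
    with hb
  have hA : ∀ m ∈ Finset.range (n + 1),
      (if m * (N + 1) ≤ n then longCycleProb N (n - m * (N + 1)) else 0) =
      ∑ l ∈ Finset.range (n + 1 - m), cycleWeight (N + 1) l * b (m + l) := by
    intro m hm
    split_ifs with h
    · rw [longCycleProb_eq_sum]
      refine (Finset.sum_congr rfl fun l _ => ?_).trans (Finset.sum_subset ?_ ?_)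
      · have h1 : (m + l) * (N + 1) = m * (N + 1) + l * (N + 1) := by ring
        simp only [hb, h1, Nat.sub_add_eq]
        congr 2
        exact propext (by omega)
      · refine Finset.range_mono ?_
        have : m ≤ m * (N + 1) := Nat.le_mul_of_pos_right _ (Nat.succ_pos _)
        omega
      · intro l _ hl
        rw [hb]
        simp only
        rw [if_neg, mul_zero]
        have h1 : (m + l) * (N + 1) = m * (N + 1) + l * (N + 1) := by ring
        have h2 : l ≤ l * (N + 1) := Nat.le_mul_of_pos_right _ (Nat.succ_pos _)
        simp only [Finset.mem_range] at hl
        omega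
    · refine (Finset.sum_eq_zero fun l _ => ?_).symm
      rw [hb]
      simp only
      rw [if_neg, mul_zero]
      have h1 : (m + l) * (N + 1) = m * (N + 1) + l * (N + 1) := by ring
      omega
  rw [Finset.sum_congr rfl fun m hm => by rw [hA m hm, Finset.mul_sum]]
  have := Finset.sum_range_diag_flip (n + 1)
    (fun m l => (-1) ^ m * cycleWeight (N + 1) m * (cycleWeight (N + 1) l * b (m + l)))
  rw [← this]
  have h2 : ∀ r ∈ Finset.range (n + 1), ∑ m ∈ Finset.range (r + 1),
      ((-1) ^ m * cycleWeight (N + 1) m * (cycleWeight (N + 1) (r - m) * b (m + (r - m)))) =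
      (if r = 0 then 1 else 0) * b r := by
    intro r _
    rw [← sum_alternating_cycleWeight (N + 1) r, Finset.sum_mul]
    refine Finset.sum_congr rfl fun m hm => ?_
    have hm : m ≤ r := by simpa [Nat.lt_succ_iff] using hm
    rw [Nat.add_sub_cancel' hm]; ring
  rw [Finset.sum_congr rfl h2]
  simp only [ite_mul, one_mul, zero_mul, Finset.sum_ite_eq', Finset.mem_range, Nat.succ_pos, if_true]
  simp [hb]

theorem hasSum_cycleWeight_mul_pow (k : ℕ) (x : ℝ) :
    HasSum (fun m => x ^ m * cycleWeight k m) (Real.exp (x / k)) := by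
  have := NormedSpace.expSeries_div_hasSum_exp (x / k : ℝ)
  rw [← Real.exp_eq_exp_ℝ] at this
  have he : (fun m => x ^ m * cycleWeight k m) = fun m => (x / k) ^ m / (m.factorial : ℝ) := by
    funext m
    rw [cycleWeight, div_pow, mul_inv, div_div, div_eq_mul_inv, mul_inv]
  rw [he]
  exact this

/-- By the inverted recursion and dominated convergence, passing from `N` to `N + 1` multiplies the
limit by `exp (-1 / (N + 1))`. -/
theorem tendsto_longCycleProb (N : ℕ) :
    Tendsto (longCycleProb N) atTop (𝓝 (Real.exp (-∑ j ∈ Finset.Icc 1 N, (1 / j : ℝ)))) := by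
  induction N with
  | zero =>
    simp only [show longCycleProb 0 = fun _ => 1 from funext longCycleProb_zero]
    simp
  | succ N ih =>
    have hs := hasSum_cycleWeight_mul_pow (N + 1) (-1)
    have hsum := hs.mul_right (Real.exp (-∑ j ∈ Finset.Icc 1 N, (1 / j : ℝ)))
    rw [← Real.exp_add] at hsum
    rw [Finset.sum_Icc_succ_top (by omega), neg_add, add_comm (-∑ k ∈ Finset.Icc 1 N, (1 / k : ℝ)),
      show -(1 / ((N + 1 : ℕ) : ℝ)) = (-1) / ((N + 1 : ℕ) : ℝ) by rw [neg_div], ← hsum.tsum_eq]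
    have hrep : longCycleProb (N + 1) = fun n => ∑' m : ℕ, (-1) ^ m * cycleWeight (N + 1) m *
        if m * (N + 1) ≤ n then longCycleProb N (n - m * (N + 1)) else 0 := by
      funext n
      rw [longCycleProb_succ_eq_sum, tsum_eq_sum]
      intro m hm
      rw [if_neg, mul_zero]
      have : n < m := by simpa using hm
      nlinarith
    rw [hrep]
    refine tendsto_tsum_of_dominated_convergence (bound := cycleWeight (N + 1)) ?_ ?_ ?_
    · have := (hasSum_cycleWeight_mul_pow (N + 1) 1).summable
      simpa using this
    · intro m
      refine Tendsto.const_mul _ ?_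
      have : Tendsto (fun n => longCycleProb N (n - m * (N + 1))) atTop
          (𝓝 (Real.exp (-∑ j ∈ Finset.Icc 1 N, (1 / j : ℝ)))) :=
        ih.comp (tendsto_sub_atTop_nat _)
      refine this.congr' ?_
      filter_upwards [eventually_ge_atTop (m * (N + 1))] with n hn
      rw [if_pos hn]
    · refine Eventually.of_forall fun n m => ?_
      rw [norm_mul, norm_mul, norm_pow, norm_neg, norm_one, one_pow, one_mul,
        Real.norm_of_nonneg (cycleWeight_nonneg _ _)]
      refine mul_le_of_le_one_right (cycleWeight_nonneg _ _) ?_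
      split_ifs
      · rw [Real.norm_of_nonneg (longCycleProb_nonneg _ _)]
        exact longCycleProb_le_one _ _
      · simp

theorem uniformProb_filter_parts_eq (N n : ℕ) {s : Multiset ℕ} (hs : ∀ i ∈ s, i ≤ N ∧ 0 < i) :
    uniformProb {π : Equiv.Perm (Fin (n + s.sum)) | π.partition.parts.filter (· ≤ N) = s} =
      partWeight s * longCycleProb N n := by
  have h := uniformProb_eq_sum_partWeight (n := n + s.sum) (fun t => t.filter (· ≤ N) = s)
  rw [h, longCycleProb, ← sum_partWeight_filter_eq (U := (· ≤ N)) (by simp) hs]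
  congr 1
  ext p
  simp only [Finset.mem_filter, Finset.mem_univ, true_and, iff_and_self]
  exact fun _ i _ => le_or_gt i N

theorem tendsto_uniformProb_count_eq (N : ℕ) (c : ℕ → ℕ) :
    Tendsto (fun n => uniformProb {π : Equiv.Perm (Fin n) |
      ∀ j ∈ Finset.Icc 1 N, π.partition.parts.count j = c j}) atTop
      (𝓝 (∏ j ∈ Finset.Icc 1 N, (Real.exp (-(1 / j : ℝ)) * cycleWeight j (c j)))) := by
  set s : Multiset ℕ := ∑ j ∈ Finset.Icc 1 N, Multiset.replicate (c j) j with hsdef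
  have hcount : ∀ i, s.count i = if i ∈ Finset.Icc 1 N then c i else 0 := by
    intro i
    rw [hsdef, Multiset.count_sum']
    simp only [Multiset.count_replicate]
    rw [Finset.sum_ite_eq']
  have hmem : ∀ i ∈ s, i ≤ N ∧ 0 < i := by
    intro i hi
    have := Multiset.count_pos.2 hi
    rw [hcount] at this
    split_ifs at this with h
    · exact ⟨(Finset.mem_Icc.1 h).2, (Finset.mem_Icc.1 h).1⟩
    · exact absurd this (lt_irrefl _)
  -- Shifting by the space taken up by the prescribed short cycles leaves `n` points for the long
  -- ones.
  rw [← tendsto_add_atTop_iff_nat s.sum]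
  have hset : ∀ n, {π : Equiv.Perm (Fin (n + s.sum)) |
      ∀ j ∈ Finset.Icc 1 N, π.partition.parts.count j = c j} =
      {π : Equiv.Perm (Fin (n + s.sum)) | π.partition.parts.filter (· ≤ N) = s} := by
    intro n
    ext π
    simp only [Set.mem_ofPred_eq, Multiset.ext, hcount, Multiset.count_filter]
    constructor
    · intro h i
      by_cases hi : i ∈ Finset.Icc 1 N
      · rw [if_pos (Finset.mem_Icc.1 hi).2, if_pos hi, h i hi]
      · rw [if_neg hi]
        split_ifs with hN
        · have : i = 0 := by simp at hi; omega
          subst this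
          exact Multiset.count_eq_zero.2 fun h0 => lt_irrefl _ (π.partition.parts_pos h0)
        · rfl
    · intro h j hj
      have := h j
      rwa [if_pos (Finset.mem_Icc.1 hj).2, if_pos hj] at this
  simp only [hset, uniformProb_filter_parts_eq N _ hmem]
  have hw : partWeight s = ∏ j ∈ Finset.Icc 1 N, cycleWeight j (c j) := by
    rw [partWeight_eq_prod (A := Finset.Icc 1 N)]
    · refine Finset.prod_congr rfl fun j hj => ?_
      rw [hcount, if_pos hj]
    · intro i hi
      have := hmem i (by simpa using hi)
      simp; omega
  rw [Finset.prod_mul_distrib, ← Real.exp_sum, mul_comm, ← hw, Finset.sum_neg_distrib]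
  exact (tendsto_longCycleProb N).const_mul _

/-! ### Independent Poisson families -/

open MeasureTheory ProbabilityTheory in
/-- Independent families of independent Poisson variables, the `j`-th variable of each family having
mean `1 / j`. -/
structure IsPoissonFamily {ι Ω : Type*} [MeasurableSpace Ω] (P : Measure Ω)
    (X : ι × ℕ → Ω → ℕ) : Prop where
  measurable : ∀ p, Measurable (X p)
  indep : iIndepFun X P
  map_eq : ∀ p, P.map (X p) = poissonMeasure (1 / (p.2 : NNReal))

namespace IsPoissonFamily

open MeasureTheory ProbabilityTheory

variable {ι Ω : Type*} [MeasurableSpace Ω] {P : Measure Ω} {X : ι × ℕ → Ω → ℕ}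

theorem infinitePi (ι : Type*) : IsPoissonFamily
    (Measure.infinitePi fun p : ι × ℕ => poissonMeasure (1 / (p.2 : NNReal)))
    (fun p ω => ω p) where
  measurable p := measurable_pi_apply p
  indep := iIndepFun_infinitePi (X := fun _ ω => ω) (by fun_prop)
  map_eq p := Measure.infinitePi_map_eval _ p

variable (h : IsPoissonFamily P X)
include h

theorem isProbabilityMeasure : IsProbabilityMeasure P := h.indep.isProbabilityMeasure

/-- For `p.2 = 0` both sides describe the point mass at `0`, since `1 / 0 = 0` and `cycleWeight 0 c`
vanishes for `c > 0`. -/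
theorem measure_eq (p : ι × ℕ) (c : ℕ) :
    P {ω | X p ω = c} = ENNReal.ofReal (Real.exp (-(1 / p.2 : ℝ)) * cycleWeight p.2 c) := by
  have : {ω | X p ω = c} = X p ⁻¹' {c} := rfl
  rw [this, ← Measure.map_apply (h.measurable p) (measurableSet_singleton c), h.map_eq,
    poissonMeasure_singleton, cycleWeight]
  congr 1
  push_cast
  rw [mul_div_assoc, div_pow, one_pow, div_div, one_div (_ * _)]

theorem measure_forall_eq (A : Finset (ι × ℕ)) (c : ι × ℕ → ℕ) :
    P {ω | ∀ p ∈ A, X p ω = c p} =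
      ENNReal.ofReal (∏ p ∈ A, (Real.exp (-(1 / p.2 : ℝ)) * cycleWeight p.2 (c p))) := by
  have : {ω | ∀ p ∈ A, X p ω = c p} = ⋂ p ∈ A, X p ⁻¹' {c p} := by ext; simp
  rw [this, h.indep.meas_biInter fun p _ => ⟨{c p}, measurableSet_singleton _, rfl⟩,
    ENNReal.ofReal_prod_of_nonneg fun p _ => mul_nonneg (Real.exp_pos _).le (cycleWeight_nonneg _ _)]
  exact Finset.prod_congr rfl fun p _ => h.measure_eq p (c p)

/-- The Poisson probability generating function at `y`. -/
theorem lintegral_pow (p : ι × ℕ) {y : ℝ} (hy : 0 ≤ y) :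
    ∫⁻ ω, ENNReal.ofReal (y ^ X p ω) ∂P = ENNReal.ofReal (Real.exp ((y - 1) / p.2)) := by
  have h1 := lintegral_map (μ := P) (f := fun m : ℕ => ENNReal.ofReal (y ^ m)) (g := X p)
    (measurable_of_countable _) (h.measurable p)
  rw [← h1, h.map_eq, lintegral_countable']
  have hs := (hasSum_cycleWeight_mul_pow p.2 y).mul_left (Real.exp (-(1 / p.2 : ℝ)))
  rw [← Real.exp_add] at hs
  rw [show (y - 1) / (p.2 : ℝ) = -(1 / (p.2 : ℝ)) + y / p.2 by ring, ← hs.tsum_eq,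
    ENNReal.ofReal_tsum_of_nonneg _ hs.summable]
  · refine tsum_congr fun m => ?_
    rw [poissonMeasure_singleton, ← ENNReal.ofReal_mul (by positivity), cycleWeight]
    congr 1
    push_cast
    rw [one_div, inv_pow, div_eq_mul_inv, mul_inv]
    ring
  · intro m
    have := cycleWeight_nonneg p.2 m
    positivity

theorem lintegral_prod_pow (A : Finset (ι × ℕ)) {y : ι × ℕ → ℝ} (hy : ∀ p, 0 ≤ y p) :
    ∫⁻ ω, ENNReal.ofReal (∏ p ∈ A, y p ^ X p ω) ∂P =
      ENNReal.ofReal (Real.exp (∑ p ∈ A, (y p - 1) / p.2)) := by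
  have h1 : ∀ ω, ENNReal.ofReal (∏ p ∈ A, y p ^ X p ω) = ∏ p ∈ A, ENNReal.ofReal (y p ^ X p ω) :=
    fun ω => ENNReal.ofReal_prod_of_nonneg fun p _ => pow_nonneg (hy p) _
  simp only [h1]
  have h2 : iIndepFun (fun p ω => ENNReal.ofReal (y p ^ X p ω)) P :=
    h.indep.comp (fun p m => ENNReal.ofReal (y p ^ m)) fun p => measurable_of_countable _
  have h3 : ∀ p, Measurable fun ω => ENNReal.ofReal (y p ^ X p ω) := fun p =>
    (measurable_of_countable (fun m : ℕ => ENNReal.ofReal (y p ^ m))).comp (h.measurable p)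
  rw [lintegral_prod_eq_prod_lintegral_of_indepFun A _ h2 h3, Real.exp_sum,
    ENNReal.ofReal_prod_of_nonneg fun p _ => (Real.exp_pos _).le]
  exact Finset.prod_congr rfl fun p _ => h.lintegral_pow p (hy p)

theorem measurable_of_finset {β : Type*} [MeasurableSpace β] (A : Finset (ι × ℕ))
    (f : (A → ℕ) → β) : Measurable fun ω => f fun p => X p ω :=
  (measurable_of_countable f).comp (measurable_pi_lambda _ fun p => h.measurable p)

theorem indepFun_of_disjoint {A B : Finset (ι × ℕ)} (hAB : Disjoint A B) :
    IndepFun (fun ω (p : A) => X p ω) (fun ω (p : B) => X p ω) P :=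
  h.indep.indepFun_finset A B hAB h.measurable

end IsPoissonFamily

open MeasureTheory ProbabilityTheory in
-- Fubini for the product law: conditionally on `U = u`, the target `H u` is a fixed set for `V`. It
-- serves to choose the long cycles after the short ones are known.
theorem ProbabilityTheory.IndepFun.mul_measure_le_measure {Ω β γ : Type*} [MeasurableSpace Ω]
    {P : Measure Ω} [IsProbabilityMeasure P] [Countable β] [MeasurableSpace β]
    [MeasurableSingletonClass β] [MeasurableSpace γ] [Countable γ] [MeasurableSingletonClass γ]
    {U : Ω → β} {V : Ω → γ} (hUV : IndepFun U V P)
    (hU : Measurable U) (hV : Measurable V) {A : Set β} {H : β → Set γ} {δ : ENNReal}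
    (hδ : ∀ u ∈ A, δ ≤ P (V ⁻¹' H u)) :
    δ * P (U ⁻¹' A) ≤ P {ω | U ω ∈ A ∧ V ω ∈ H (U ω)} := by
  have hprod := (indepFun_iff_map_prod_eq_prod_map_map hU.aemeasurable hV.aemeasurable).1 hUV
  have h1 : {ω | U ω ∈ A ∧ V ω ∈ H (U ω)} = (fun ω => (U ω, V ω)) ⁻¹' {q | q.1 ∈ A ∧ q.2 ∈ H q.1} :=
    rfl
  have hmV : IsProbabilityMeasure (P.map V) := Measure.isProbabilityMeasure_map hV.aemeasurable
  have hmU : IsProbabilityMeasure (P.map U) := Measure.isProbabilityMeasure_map hU.aemeasurable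
  have hA : MeasurableSet A := A.to_countable.measurableSet
  have hS : MeasurableSet {q : β × γ | q.1 ∈ A ∧ q.2 ∈ H q.1} := (Set.to_countable _).measurableSet
  rw [h1, ← Measure.map_apply (hU.prodMk hV) hS, hprod, Measure.prod_apply hS,
    ← Measure.map_apply hU hA, ← setLIntegral_const]
  rw [← lintegral_indicator hA]
  refine lintegral_mono fun u => ?_
  by_cases hu : u ∈ A
  · rw [Set.indicator_of_mem hu]
    have : Prod.mk u ⁻¹' {q : β × γ | q.1 ∈ A ∧ q.2 ∈ H q.1} = H u := by
      ext v; simp [hu]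
    rw [this, Measure.map_apply hV (H u).to_countable.measurableSet]
    exact hδ u hu
  · rw [Set.indicator_of_notMem hu]
    exact zero_le

/-! ### Fourier analysis on `ZMod M` -/

/-- Cauchy–Schwarz over the fibres of `f`: few collisions force a large image. -/
theorem card_sq_le_card_image_mul_card_filter {B G : Type*} [Fintype B] [DecidableEq G] (f : B → G) :
    Fintype.card B ^ 2 ≤ (Finset.univ.image f).card *
      (Finset.univ.filter fun p : B × B => f p.1 = f p.2).card := by
  classical
  have h1 : (Fintype.card B : ℕ) = ∑ g ∈ Finset.univ.image f, (Finset.univ.filter fun x => f x = g).card :=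
    Finset.card_eq_sum_card_image f _
  have h2 : (Finset.univ.filter fun p : B × B => f p.1 = f p.2).card =
      ∑ g ∈ Finset.univ.image f, (Finset.univ.filter fun x => f x = g).card ^ 2 := by
    rw [Finset.card_eq_sum_card_fiberwise (f := fun p : B × B => f p.1) (t := Finset.univ.image f)]
    · refine Finset.sum_congr rfl fun g _ => ?_
      rw [sq, ← Finset.card_product]
      congr 1
      ext p
      simp only [Finset.mem_filter, Finset.mem_univ, true_and, Finset.mem_product]
      constructor
      · rintro ⟨h, h'⟩; exact ⟨h', h ▸ h'⟩
      · rintro ⟨h, h'⟩; exact ⟨h.trans h'.symm, h⟩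
    · intro p _; simp
  rw [h2, h1]
  exact sq_sum_le_card_mul_sum_sq

/-- The Fourier transform of the value distribution of `v`. -/
noncomputable def charSum {M : ℕ} [NeZero M] {B : Type*} [Fintype B] (v : B → ZMod M) (a : ZMod M) : ℂ :=
  ∑ x, ZMod.stdAddChar (a * v x)

/-- By orthogonality of characters the double sum is `M ^ 2` times the number of collisions of the
pair of differences. The third frequency is `-(a + b)` because `v₂` is subtracted in both
coordinates. -/
theorem card_mul_sq_le {M : ℕ} [NeZero M] {B₀ B₁ B₂ : Type*} [Fintype B₀] [Fintype B₁] [Fintype B₂]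
    (v₀ : B₀ → ZMod M) (v₁ : B₁ → ZMod M) (v₂ : B₂ → ZMod M) :
    ((Fintype.card B₀ * Fintype.card B₁ * Fintype.card B₂ : ℝ)) ^ 2 * M ^ 2 ≤
      (Finset.univ.image fun x : B₀ × B₁ × B₂ => (v₀ x.1 - v₂ x.2.2, v₁ x.2.1 - v₂ x.2.2)).card *
      ∑ a : ZMod M, ∑ b : ZMod M,
        ‖charSum v₀ a‖ ^ 2 * ‖charSum v₁ b‖ ^ 2 * ‖charSum v₂ (-(a + b))‖ ^ 2 := by
  set f : B₀ × B₁ × B₂ → ZMod M × ZMod M := fun x => (v₀ x.1 - v₂ x.2.2, v₁ x.2.1 - v₂ x.2.2) with hf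
  have hprim := ZMod.isPrimitive_stdAddChar M
  have hE : ∑ a : ZMod M, ∑ b : ZMod M,
        ‖charSum v₀ a‖ ^ 2 * ‖charSum v₁ b‖ ^ 2 * ‖charSum v₂ (-(a + b))‖ ^ 2 =
      M ^ 2 * ((Finset.univ.filter fun p : (B₀ × B₁ × B₂) × (B₀ × B₁ × B₂) => f p.1 = f p.2).card : ℝ) := by
    have h1 : ∀ a b : ZMod M,
        ((‖charSum v₀ a‖ ^ 2 * ‖charSum v₁ b‖ ^ 2 * ‖charSum v₂ (-(a + b))‖ ^ 2 : ℝ) : ℂ) =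
        ∑ p : (B₀ × B₁ × B₂) × (B₀ × B₁ × B₂),
          ZMod.stdAddChar (a * ((f p.1).1 - (f p.2).1)) * ZMod.stdAddChar (b * ((f p.1).2 - (f p.2).2)) := by
      intro a b
      have h2 : charSum v₀ a * charSum v₁ b * charSum v₂ (-(a + b)) =
          ∑ x : B₀ × B₁ × B₂, ZMod.stdAddChar (a * (f x).1 + b * (f x).2) := by
        rw [charSum, charSum, charSum, Finset.sum_mul_sum, Finset.sum_mul, Fintype.sum_prod_type]
        refine Finset.sum_congr rfl fun x _ => ?_
        rw [Finset.sum_mul_sum, Fintype.sum_prod_type]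
        refine Finset.sum_congr rfl fun y _ => Finset.sum_congr rfl fun z _ => ?_
        rw [← AddChar.map_add_eq_mul, ← AddChar.map_add_eq_mul]
        congr 1; ring
      rw [← mul_pow, ← mul_pow, ← norm_mul, ← norm_mul, h2, Complex.ofReal_pow, ← Complex.mul_conj',
        map_sum, Finset.sum_mul_sum, Fintype.sum_prod_type (α₁ := B₀ × B₁ × B₂)]
      refine Finset.sum_congr rfl fun x _ => Finset.sum_congr rfl fun y _ => ?_
      rw [← AddChar.map_neg_eq_conj, ← AddChar.map_add_eq_mul, ← AddChar.map_add_eq_mul]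
      congr 1; ring
    have hC : ((∑ a : ZMod M, ∑ b : ZMod M,
        ‖charSum v₀ a‖ ^ 2 * ‖charSum v₁ b‖ ^ 2 * ‖charSum v₂ (-(a + b))‖ ^ 2 : ℝ) : ℂ) =
      ((M ^ 2 * ((Finset.univ.filter fun p : (B₀ × B₁ × B₂) × (B₀ × B₁ × B₂) =>
        f p.1 = f p.2).card : ℝ) : ℝ) : ℂ) := by
      simp only [Complex.ofReal_sum, h1]
      rw [Finset.sum_congr rfl fun a _ => Finset.sum_comm, Finset.sum_comm]
      simp only [← Finset.mul_sum, ← Finset.sum_mul, AddChar.sum_mulShift _ hprim, ZMod.card]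
      rw [Finset.card_filter]
      push_cast
      rw [Finset.mul_sum]
      refine Finset.sum_congr rfl fun p _ => ?_
      simp only [sub_eq_zero, Prod.ext_iff (x := f p.1)]
      split_ifs <;> simp_all [sq]
    exact_mod_cast hC
  rw [hE]
  have h := card_sq_le_card_image_mul_card_filter f
  rw [Fintype.card_prod, Fintype.card_prod] at h
  have h' : ((Fintype.card B₀ * (Fintype.card B₁ * Fintype.card B₂) : ℝ)) ^ 2 ≤
    ((Finset.univ.image f).card : ℝ) *
      ((Finset.univ.filter fun p : (B₀ × B₁ × B₂) × (B₀ × B₁ × B₂) => f p.1 = f p.2).card : ℝ) := by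
    exact_mod_cast h
  have hM : (0 : ℝ) ≤ (M : ℝ) ^ 2 := by positivity
  nlinarith [mul_le_mul_of_nonneg_right h' hM]

/-! ### Subset sums and their Fourier transforms -/

/-- `s` is a sum of cycle lengths in `I`, each `j` being used at most `c j` times. -/
def IsSubsum (I : Finset ℕ) (c : ℕ → ℕ) (s : ℕ) : Prop :=
  ∃ m : ℕ → ℕ, (∀ j ∈ I, m j ≤ c j) ∧ ∑ j ∈ I, j * m j = s

/-- The squared absolute value of the normalised Fourier transform of the subset sums of the
multiset in which each `j ∈ I` occurs `c j` times. -/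
noncomputable def cosProd (M : ℕ) (I : Finset ℕ) (c : ℕ → ℕ) (a : ZMod M) : ℝ :=
  ∏ j ∈ I, (Real.cos (Real.pi * j * a.val / M) ^ 2) ^ c j

theorem norm_one_add_stdAddChar_sq {M : ℕ} [NeZero M] (a : ZMod M) (j : ℕ) :
    ‖1 + (ZMod.stdAddChar (a * (j : ZMod M)) : ℂ)‖ ^ 2 = 4 * Real.cos (Real.pi * j * a.val / M) ^ 2 := by
  have h1 : a * (j : ZMod M) = ((a.val * j : ℕ) : ℤ) := by
    push_cast; rw [ZMod.natCast_zmod_val]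
  have h2 : (ZMod.stdAddChar (a * (j : ZMod M)) : ℂ) =
      Complex.exp ((Real.pi * j * a.val / M : ℝ) * Complex.I) ^ 2 := by
    rw [h1, ZMod.stdAddChar_coe, ← Complex.exp_nat_mul]
    congr 1
    push_cast; ring
  set x := Real.pi * j * a.val / M
  have h3 : 1 + Complex.exp ((x : ℝ) * Complex.I) ^ 2 =
      Complex.exp ((x : ℝ) * Complex.I) * (2 * Complex.cos x) := by
    rw [Complex.two_cos, mul_add, ← Complex.exp_add, ← Complex.exp_add, sq, ← Complex.exp_add]
    rw [add_comm]
    congr 1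
    rw [show (x : ℂ) * Complex.I + -x * Complex.I = 0 by ring, Complex.exp_zero]
  rw [h2, h3, norm_mul, Complex.norm_exp_ofReal_mul_I, one_mul, norm_mul, ← Complex.ofReal_cos,
    Complex.norm_real, mul_pow, Real.norm_eq_abs, sq_abs]
  norm_num

theorem map_addChar_sum {ι A R : Type*} [AddCommMonoid A] [CommMonoid R] (ψ : AddChar A R)
    (s : Finset ι) (f : ι → A) : ψ (∑ i ∈ s, f i) = ∏ i ∈ s, ψ (f i) := by
  classical
  induction s using Finset.induction_on with
  | empty => simp
  | insert a s ha ih => rw [Finset.sum_insert ha, Finset.prod_insert ha, AddChar.map_add_eq_mul, ih]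

/-- The subset sums of the multiset in which each `j ∈ I` occurs `c j` times, as a function on the
subsets of `Σ j ∈ I, Fin (c j)`. -/
theorem exists_subsum_charSum (M : ℕ) [NeZero M] (I : Finset ℕ) (c : ℕ → ℕ) :
    ∃ v : Finset ((j : I) × Fin (c j)) → ℕ, (∀ x, IsSubsum I c (v x)) ∧
      ∀ a : ZMod M, ‖charSum (fun x => (v x : ZMod M)) a‖ ^ 2 =
        (Fintype.card (Finset ((j : I) × Fin (c j))) : ℝ) ^ 2 * cosProd M I c a := by
  classical
  refine ⟨fun x => ∑ p ∈ x, (p.1 : ℕ), fun x => ?_, fun a => ?_⟩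
  · refine ⟨fun j => (x.filter fun p => (p.1 : ℕ) = j).card, fun j hj => ?_, ?_⟩
    · calc (x.filter fun p => (p.1 : ℕ) = j).card
          ≤ ((Finset.univ : Finset (Fin (c j))).image
            fun i => (⟨⟨j, hj⟩, i⟩ : (j : I) × Fin (c j))).card := by
            apply Finset.card_le_card
            rintro ⟨⟨k, hk⟩, i⟩ hp
            have := (Finset.mem_filter.1 hp).2
            simp only at this
            subst this
            simp
        _ ≤ c j := Finset.card_image_le.trans (by simp)
    · simp only
      rw [← Finset.sum_fiberwise_of_maps_to (s := x) (g := fun p : (j : I) × Fin (c j) => (p.1 : ℕ)) (t := I)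
        (fun p _ => p.1.2)]
      refine Finset.sum_congr rfl fun j _ => ?_
      rw [Finset.sum_congr rfl fun p hp => (Finset.mem_filter.1 hp).2, Finset.sum_const, smul_eq_mul,
        mul_comm]
  · have h1 : charSum (fun x : Finset ((j : I) × Fin (c j)) => ((∑ p ∈ x, (p.1 : ℕ) : ℕ) : ZMod M)) a =
        ∏ j ∈ I, (1 + (ZMod.stdAddChar (a * (j : ZMod M)) : ℂ)) ^ c j := by
      rw [← Finset.prod_coe_sort I fun j => (1 + (ZMod.stdAddChar (a * (j : ZMod M)) : ℂ)) ^ c j]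
      have h2 : ∏ j : I, (1 + (ZMod.stdAddChar (a * ((j : ℕ) : ZMod M)) : ℂ)) ^ c j =
          ∏ p : (j : I) × Fin (c j), (1 + (ZMod.stdAddChar (a * ((p.1 : ℕ) : ZMod M)) : ℂ)) := by
        rw [Fintype.prod_sigma]
        simp
      rw [h2, Finset.prod_one_add, charSum, Finset.powerset_univ]
      refine Finset.sum_congr rfl fun x _ => ?_
      push_cast
      rw [Finset.mul_sum]
      exact map_addChar_sum _ x _
    rw [h1, norm_prod, ← Finset.prod_pow]
    have h4 : ((Fintype.card (Finset ((j : I) × Fin (c j))) : ℝ)) ^ 2 = ∏ j ∈ I, (4 : ℝ) ^ c j := by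
      rw [Fintype.card_finset, Fintype.card_sigma, ← Finset.prod_coe_sort I fun j => (4 : ℝ) ^ c j,
        Finset.prod_pow_eq_pow_sum]
      push_cast
      rw [← pow_mul, mul_comm, pow_mul]
      norm_num
    rw [h4, cosProd, ← Finset.prod_mul_distrib]
    refine Finset.prod_congr rfl fun j _ => ?_
    rw [norm_pow, ← pow_mul, mul_comm (c j), pow_mul, norm_one_add_stdAddChar_sq, mul_pow]

theorem exists_subsum_differences (M : ℕ) [NeZero M] (I : Finset ℕ) (c : Fin 3 → ℕ → ℕ) :
    ∃ S : Finset (ZMod M × ZMod M),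
      (∀ q ∈ S, ∃ s : Fin 3 → ℕ, (∀ t, IsSubsum I (c t) (s t)) ∧
        q.1 = (s 0 : ZMod M) - s 2 ∧ q.2 = (s 1 : ZMod M) - s 2) ∧
      (M : ℝ) ^ 2 ≤ S.card * ∑ a : ZMod M, ∑ b : ZMod M,
        cosProd M I (c 0) a * cosProd M I (c 1) b * cosProd M I (c 2) (-(a + b)) := by
  classical
  choose v hv hv' using fun t => exists_subsum_charSum M I (c t)
  refine ⟨Finset.univ.image fun x : Finset ((j : I) × Fin (c 0 j)) × Finset ((j : I) × Fin (c 1 j)) ×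
    Finset ((j : I) × Fin (c 2 j)) => ((v 0 x.1 : ZMod M) - v 2 x.2.2, (v 1 x.2.1 : ZMod M) - v 2 x.2.2),
    ?_, ?_⟩
  · intro q hq
    obtain ⟨x, -, rfl⟩ := Finset.mem_image.1 hq
    refine ⟨![v 0 x.1, v 1 x.2.1, v 2 x.2.2], fun t => ?_, rfl, rfl⟩
    fin_cases t
    · exact hv 0 _
    · exact hv 1 _
    · exact hv 2 _
  · have h := card_mul_sq_le (fun x => (v 0 x : ZMod M)) (fun x => (v 1 x : ZMod M))
      (fun x => (v 2 x : ZMod M))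
    simp only [hv'] at h
    set N0 := (Fintype.card (Finset ((j : I) × Fin (c 0 j))) : ℝ)
    set N1 := (Fintype.card (Finset ((j : I) × Fin (c 1 j))) : ℝ)
    set N2 := (Fintype.card (Finset ((j : I) × Fin (c 2 j))) : ℝ)
    have hN : 0 < (N0 * N1 * N2) ^ 2 := by
      have h0 : 0 < N0 := Nat.cast_pos.2 Fintype.card_pos
      have h1 : 0 < N1 := Nat.cast_pos.2 Fintype.card_pos
      have h2 : 0 < N2 := Nat.cast_pos.2 Fintype.card_pos
      positivity
    have hsum : ∑ a : ZMod M, ∑ b : ZMod M, N0 ^ 2 * cosProd M I (c 0) a * (N1 ^ 2 * cosProd M I (c 1) b) *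
        (N2 ^ 2 * cosProd M I (c 2) (-(a + b))) = (N0 * N1 * N2) ^ 2 * ∑ a : ZMod M, ∑ b : ZMod M,
        cosProd M I (c 0) a * cosProd M I (c 1) b * cosProd M I (c 2) (-(a + b)) := by
      rw [Finset.mul_sum]
      refine Finset.sum_congr rfl fun a _ => ?_
      rw [Finset.mul_sum]
      refine Finset.sum_congr rfl fun b _ => ?_
      ring
    rw [hsum, mul_left_comm] at h
    exact le_of_mul_le_mul_left h hN

/-! ### Harmonic and trigonometric sums -/

/-- Telescoping, using `log (1 + x) ≤ x`. -/
theorem log_sub_log_le_sum_inv (h k : ℕ) (hk : h ≤ k) :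
    Real.log (k + 1) - Real.log (h + 1) ≤ ∑ j ∈ Finset.Ioc h k, (1 / j : ℝ) := by
  induction k, hk using Nat.le_induction with
  | base => simp
  | succ k hk ih =>
    rw [Finset.sum_Ioc_succ_top hk]
    have h1 : Real.log ((k + 1 : ℕ) + 1) - Real.log (k + 1) ≤ 1 / ((k + 1 : ℕ) : ℝ) := by
      rw [← Real.log_div (by positivity) (by positivity)]
      refine (Real.log_le_sub_one_of_pos (by positivity)).trans (le_of_eq ?_)
      push_cast
      field_simp
      ring
    linarith

theorem mul_log_two_le_sum_inv {i R : ℕ} (hi : i ≤ R) :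
    ((R - i : ℕ) - 1 : ℝ) * Real.log 2 ≤ ∑ j ∈ Finset.Ioc ((2 : ℕ) ^ i) (2 ^ R), (1 / j : ℝ) := by
  refine le_trans ?_ (log_sub_log_le_sum_inv (2 ^ i) (2 ^ R) (Nat.pow_le_pow_right two_pos hi))
  have h1 : (R : ℝ) * Real.log 2 ≤ Real.log ((2 ^ R : ℕ) + 1) := by
    rw [← Real.log_pow]
    apply Real.log_le_log (by positivity)
    push_cast; linarith
  have h2 : Real.log ((2 ^ i : ℕ) + 1) ≤ (i + 1 : ℝ) * Real.log 2 := by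
    have : ((i : ℝ) + 1) = ((i + 1 : ℕ) : ℝ) := by push_cast; rfl
    rw [this, ← Real.log_pow]
    apply Real.log_le_log (by positivity)
    push_cast
    have : (1 : ℝ) ≤ 2 ^ i := one_le_pow₀ (by norm_num)
    rw [pow_succ]; linarith
  rw [Nat.cast_sub hi]
  linarith

theorem sum_inv_Ioc_le (M D : ℕ) : ∑ j ∈ Finset.Ioc M ((D + 1) * M), (1 / j : ℝ) ≤ D := by
  rcases Nat.eq_zero_or_pos M with rfl | hM
  · simp
  calc ∑ j ∈ Finset.Ioc M ((D + 1) * M), (1 / j : ℝ)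
      ≤ ∑ _j ∈ Finset.Ioc M ((D + 1) * M), (1 / M : ℝ) := by
        refine Finset.sum_le_sum fun j hj => ?_
        have : M ≤ j := (Finset.mem_Ioc.1 hj).1.le
        gcongr
    _ = D := by
        rw [Finset.sum_const, Nat.card_Ioc, nsmul_eq_mul, add_mul, one_mul, Nat.add_sub_cancel]
        push_cast
        field_simp

/-- Multiplication by `2 sin (π θ)` telescopes the cosines into differences of sines; summation by
parts then uses that `1 / j` decreases. -/
theorem sum_cos_div_mul_sin_le {θ : ℝ} {h k : ℕ} (h0 : 0 < h) (hk : h ≤ k) :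
    (∑ j ∈ Finset.Ioc h k, Real.cos (2 * (Real.pi * j * θ)) / j) * (2 * Real.sin (Real.pi * θ)) ≤
      2 / h := by
  -- The extra term is the boundary term of the summation by parts, kept so that the induction
  -- closes.
  have key : (∑ j ∈ Finset.Ioc h k, Real.cos (2 * (Real.pi * j * θ)) / j) *
      (2 * Real.sin (Real.pi * θ)) ≤ 2 / h - (1 - Real.sin ((2 * k + 1) * (Real.pi * θ))) / k := by
    induction k, hk using Nat.le_induction with
    | base =>
      simp only [Finset.Ioc_self, Finset.sum_empty, zero_mul]
      rw [← sub_div]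
      apply div_nonneg _ (Nat.cast_nonneg _)
      linarith [Real.neg_one_le_sin ((2 * h + 1) * (Real.pi * θ))]
    | succ k hk ih =>
      rw [Finset.sum_Ioc_succ_top hk, add_mul]
      have h1 : Real.cos (2 * (Real.pi * (k + 1 : ℕ) * θ)) * (2 * Real.sin (Real.pi * θ)) =
          Real.sin ((2 * (k + 1 : ℕ) + 1) * (Real.pi * θ)) -
          Real.sin ((2 * k + 1) * (Real.pi * θ)) := by
        rw [Real.sin_sub_sin]
        push_cast
        rw [show ((2 * ((k : ℝ) + 1) + 1) * (Real.pi * θ) - (2 * k + 1) * (Real.pi * θ)) / 2 =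
          Real.pi * θ by ring, show ((2 * ((k : ℝ) + 1) + 1) * (Real.pi * θ) +
          (2 * k + 1) * (Real.pi * θ)) / 2 = 2 * (Real.pi * (k + 1) * θ) by ring]
        ring
      rw [div_mul_eq_mul_div, h1]
      set s := Real.sin ((2 * k + 1) * (Real.pi * θ)) with hs
      set s' := Real.sin ((2 * (k + 1 : ℕ) + 1) * (Real.pi * θ)) with hs'
      have hs1 : 0 ≤ 1 - s := by linarith [Real.sin_le_one ((2 * k + 1) * (Real.pi * θ))]
      have hk0 : (0 : ℝ) < k := by exact_mod_cast h0.trans_le hk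
      have h2 : (1 - s) / ((k + 1 : ℕ) : ℝ) ≤ (1 - s) / k := by
        gcongr
        omega
      have h3 : (s' - s) / ((k + 1 : ℕ) : ℝ) = (1 - s) / ((k + 1 : ℕ) : ℝ) - (1 - s') / ((k + 1 : ℕ) : ℝ) := by
        rw [← sub_div]; congr 1; ring
      linarith
  have h4 : 0 ≤ (1 - Real.sin ((2 * k + 1) * (Real.pi * θ))) / k :=
    div_nonneg (by linarith [Real.sin_le_one ((2 * k + 1) * (Real.pi * θ))]) (Nat.cast_nonneg _)
  linarith

theorem two_mul_min_le_sin {θ : ℝ} (h0 : 0 ≤ θ) (h1 : θ ≤ 1) :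
    2 * min θ (1 - θ) ≤ Real.sin (Real.pi * θ) := by
  have key : ∀ x : ℝ, 0 ≤ x → x ≤ 1 / 2 → 2 * x ≤ Real.sin (Real.pi * x) := by
    intro x hx hx'
    have := Real.mul_le_sin (x := Real.pi * x) (by positivity) (by nlinarith [Real.pi_pos])
    have e : 2 / Real.pi * (Real.pi * x) = 2 * x := by
      field_simp
    linarith
  rcases le_total θ (1 / 2) with h | h
  · exact (mul_le_mul_of_nonneg_left (min_le_left _ _) two_pos.le).trans (key θ h0 h)
  · have := key (1 - θ) (by linarith) (by linarith)
    rw [show Real.pi * (1 - θ) = Real.pi - Real.pi * θ by ring, Real.sin_pi_sub] at this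
    exact (mul_le_mul_of_nonneg_left (min_le_right _ _) two_pos.le).trans this

/-- Since `2cos² x - 1 = cos 2x`, this is the cosine sum with `θ = v / M`. The hypothesis `hh` says
that `h` is at least the inverse distance from `θ` to the integers, so `sin (π θ) ≥ 2 / h`. -/
theorem sum_two_cos_sq_sub_one_div_le {M h v k : ℕ} (hM : 0 < M) (hv : v < M)
    (hh : M ≤ h * min v (M - v)) (hk : h ≤ k) :
    ∑ j ∈ Finset.Ioc h k, (2 * Real.cos (Real.pi * j * v / M) ^ 2 - 1) / j ≤ 1 / 2 := by
  have hpos : 0 < h * min v (M - v) := hM.trans_le hh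
  have h0 : 0 < h := Nat.pos_of_mul_pos_right hpos
  have hm : 0 < min v (M - v) := Nat.pos_of_mul_pos_left hpos
  have hMr : (0 : ℝ) < M := by exact_mod_cast hM
  have hhr : (0 : ℝ) < h := by exact_mod_cast h0
  have h1 := sum_cos_div_mul_sin_le (θ := (v : ℝ) / M) h0 hk
  have h2 := two_mul_min_le_sin (θ := (v : ℝ) / M) (by positivity)
    (by rw [div_le_one hMr]; exact_mod_cast hv.le)
  have h3 : min ((v : ℝ) / M) (1 - v / M) = ((min v (M - v) : ℕ) : ℝ) / M := by
    rw [Nat.cast_min, Nat.cast_sub hv.le, ← min_div_div_right hMr.le, sub_div, div_self hMr.ne']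
  rw [h3] at h2
  have hsum : ∑ j ∈ Finset.Ioc h k, (2 * Real.cos (Real.pi * j * v / M) ^ 2 - 1) / j =
      ∑ j ∈ Finset.Ioc h k, Real.cos (2 * (Real.pi * j * ((v : ℝ) / M))) / j := by
    refine Finset.sum_congr rfl fun j _ => ?_
    rw [Real.cos_two_mul, mul_div_assoc]
  rw [hsum]
  set C := ∑ j ∈ Finset.Ioc h k, Real.cos (2 * (Real.pi * j * ((v : ℝ) / M))) / j
  by_contra! hcon
  have hmr : (M : ℝ) ≤ h * ((min v (M - v) : ℕ) : ℝ) := by exact_mod_cast hh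
  have h4 : 1 / (h : ℝ) ≤ ((min v (M - v) : ℕ) : ℝ) / M := by
    rw [div_le_div_iff₀ hhr hMr]; linarith
  have h5 : 2 / (h : ℝ) ≤ Real.sin (Real.pi * ((v : ℝ) / M)) := by
    have : 2 / (h : ℝ) = 2 * (1 / h) := by ring
    linarith
  have h6 : (0 : ℝ) < 2 / h := by positivity
  nlinarith

/-! ### Levels of frequencies -/

/-- The binary order of magnitude of the distance from `a` to `0` in `ZMod (2 ^ R)`. -/
def freqLevel (R : ℕ) (a : ZMod (2 ^ R)) : ℕ := Nat.log 2 (min a.val (2 ^ R - a.val))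

/-- The level of a frequency, truncated at `R - Q`. -/
def truncLevel (Q R : ℕ) (a : ZMod (2 ^ R)) : ℕ := min (freqLevel R a) (R - Q)

/-- There are `2 ^ e` integers in `[2 ^ e, 2 ^ (e + 1))`, which gives a geometric series of ratio
`2x`; the leading `1` in `key` pays for `v = 0`. -/
theorem sum_range_pow_log_le {x : ℝ} (h0 : 0 ≤ x) (h1 : 2 * x < 1) (n : ℕ) :
    ∑ v ∈ Finset.range (2 ^ n), x ^ Nat.log 2 v ≤ 2 / (1 - 2 * x) := by
  have key : ∑ v ∈ Finset.range (2 ^ n), x ^ Nat.log 2 v ≤ 1 + ∑ e ∈ Finset.range n, (2 * x) ^ e := by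
    induction n with
    | zero => simp
    | succ n ih =>
      rw [Finset.sum_range_succ, pow_succ, mul_two, Finset.sum_range_add]
      have : ∑ v ∈ Finset.range (2 ^ n), x ^ Nat.log 2 (2 ^ n + v) = (2 * x) ^ n := by
        rw [Finset.sum_congr rfl (g := fun _ => x ^ n), Finset.sum_const, Finset.card_range,
          nsmul_eq_mul, mul_pow]
        · push_cast; rfl
        · intro v hv
          congr 1
          rw [Nat.log_eq_iff (Or.inr ⟨by norm_num, by positivity⟩)]
          have := Finset.mem_range.1 hv
          constructor
          · omega
          · rw [pow_succ]; omega
      linarith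
  refine key.trans ?_
  have hgeom : ∑ e ∈ Finset.range n, (2 * x) ^ e ≤ 1 / (1 - 2 * x) := by
    have := (summable_geometric_of_lt_one (by positivity) h1).sum_le_tsum (Finset.range n)
      (fun _ _ => by positivity)
    rwa [tsum_geometric_of_lt_one (by positivity) h1, ← one_div] at this
  have h2 : 1 ≤ 1 / (1 - 2 * x) := by
    rw [le_div_iff₀ (by linarith)]; linarith
  have h3 : 2 / (1 - 2 * x) = 1 / (1 - 2 * x) + 1 / (1 - 2 * x) := by ring
  linarith

theorem sum_pow_freqLevel_le {x : ℝ} (h0 : 0 ≤ x) (h1 : 2 * x < 1) (R : ℕ) :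
    ∑ a : ZMod (2 ^ R), x ^ freqLevel R a ≤ 4 / (1 - 2 * x) := by
  have hsum : ∀ f : ℕ → ℝ, ∑ a : ZMod (2 ^ R), f a.val = ∑ v ∈ Finset.range (2 ^ R), f v := by
    intro f
    refine Finset.sum_bij (fun a _ => a.val) ?_ ?_ ?_ ?_
    · intro a _; exact Finset.mem_range.2 a.val_lt
    · intro a _ b _ hab; exact ZMod.val_injective _ hab
    · intro v hv
      exact ⟨(v : ZMod (2 ^ R)), Finset.mem_univ _, ZMod.val_cast_of_lt (Finset.mem_range.1 hv)⟩
    · intro a _; rfl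
  have h2 := sum_range_pow_log_le h0 h1 R
  have h3 : ∑ v ∈ Finset.range (2 ^ R), x ^ Nat.log 2 (2 ^ R - v) ≤ 2 / (1 - 2 * x) := by
    refine le_trans ?_ h2
    rw [← Finset.sum_range_reflect (fun v => x ^ Nat.log 2 v)]
    refine Finset.sum_le_sum fun v _ => pow_le_pow_of_le_one h0 (by linarith) ?_
    exact Nat.log_mono_right (by omega)
  calc ∑ a : ZMod (2 ^ R), x ^ freqLevel R a
      ≤ ∑ a : ZMod (2 ^ R), (x ^ Nat.log 2 a.val + x ^ Nat.log 2 (2 ^ R - a.val)) := by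
        refine Finset.sum_le_sum fun a _ => ?_
        have p1 : 0 ≤ x ^ Nat.log 2 a.val := by positivity
        have p2 : 0 ≤ x ^ Nat.log 2 (2 ^ R - a.val) := by positivity
        rw [freqLevel]
        rcases min_choice a.val (2 ^ R - a.val) with h | h <;> rw [h] <;> linarith
    _ = ∑ v ∈ Finset.range (2 ^ R), x ^ Nat.log 2 v +
        ∑ v ∈ Finset.range (2 ^ R), x ^ Nat.log 2 (2 ^ R - v) := by
        rw [Finset.sum_add_distrib, hsum (fun v => x ^ Nat.log 2 v),
          hsum (fun v => x ^ Nat.log 2 (2 ^ R - v))]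
    _ ≤ 2 / (1 - 2 * x) + 2 / (1 - 2 * x) := add_le_add h2 h3
    _ = 4 / (1 - 2 * x) := by ring

theorem sum_pow_truncLevel_le {x : ℝ} (h0 : 0 ≤ x) (h1 : 2 * x < 1) (Q R : ℕ) :
    ∑ a : ZMod (2 ^ R), x ^ truncLevel Q R a ≤ 4 / (1 - 2 * x) + 2 ^ R * x ^ (R - Q) := by
  calc ∑ a : ZMod (2 ^ R), x ^ truncLevel Q R a
      ≤ ∑ a : ZMod (2 ^ R), (x ^ freqLevel R a + x ^ (R - Q)) := by
        refine Finset.sum_le_sum fun a _ => ?_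
        have p1 : 0 ≤ x ^ freqLevel R a := by positivity
        have p2 : 0 ≤ x ^ (R - Q) := by positivity
        rw [truncLevel]
        rcases min_choice (freqLevel R a) (R - Q) with h | h <;> rw [h] <;> linarith
    _ ≤ _ := by
        rw [Finset.sum_add_distrib, Finset.sum_const, Finset.card_univ, ZMod.card, nsmul_eq_mul]
        push_cast
        linarith [sum_pow_freqLevel_le h0 h1 R]

/-- The two smallest of three numbers add up to at most two thirds of the total. This trades decay
in three dependent frequencies for stronger decay in two independent ones. -/
theorem pow_two_mul_le_sum_pow {τ : ℝ} (h0 : 0 ≤ τ) (h1 : τ ≤ 1) (a b c : ℕ) :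
    τ ^ (2 * (a + b + c)) ≤ (τ ^ 3) ^ a * (τ ^ 3) ^ b + (τ ^ 3) ^ b * (τ ^ 3) ^ c +
      (τ ^ 3) ^ a * (τ ^ 3) ^ c := by
  simp only [← pow_mul, ← pow_add]
  have p : ∀ n : ℕ, 0 ≤ τ ^ n := fun n => pow_nonneg h0 n
  have q : ∀ m n : ℕ, m ≤ n → τ ^ n ≤ τ ^ m := fun m n h => pow_le_pow_of_le_one h0 h1 h
  have h : 3 * a + 3 * b ≤ 2 * (a + b + c) ∨ 3 * b + 3 * c ≤ 2 * (a + b + c) ∨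
      3 * a + 3 * c ≤ 2 * (a + b + c) := by omega
  rcases h with h | h | h <;> have := q _ _ h <;>
    linarith [p (3 * a + 3 * b), p (3 * b + 3 * c), p (3 * a + 3 * c)]

theorem sum_sum_pow_truncLevel_le {τ : ℝ} (h0 : 0 ≤ τ) (h1 : τ ≤ 1) (Q R : ℕ) :
    ∑ a : ZMod (2 ^ R), ∑ b : ZMod (2 ^ R),
      τ ^ (2 * (truncLevel Q R a + truncLevel Q R b + truncLevel Q R (-(a + b)))) ≤
    3 * (∑ a : ZMod (2 ^ R), (τ ^ 3) ^ truncLevel Q R a) ^ 2 := by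
  set f : ZMod (2 ^ R) → ℝ := fun a => (τ ^ 3) ^ truncLevel Q R a with hf
  have hshift : ∀ a : ZMod (2 ^ R), ∑ b : ZMod (2 ^ R), f (-(a + b)) = ∑ b, f b := fun a =>
    Fintype.sum_equiv ((Equiv.addLeft a).trans (Equiv.neg _)) _ _ fun b => rfl
  have hshift' : ∀ b : ZMod (2 ^ R), ∑ a : ZMod (2 ^ R), f (-(a + b)) = ∑ b, f b := fun b =>
    Fintype.sum_equiv ((Equiv.addRight b).trans (Equiv.neg _)) _ _ fun a => rfl
  calc _ ≤ ∑ a : ZMod (2 ^ R), ∑ b : ZMod (2 ^ R),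
        (f a * f b + f b * f (-(a + b)) + f a * f (-(a + b))) :=
        Finset.sum_le_sum fun a _ => Finset.sum_le_sum fun b _ => pow_two_mul_le_sum_pow h0 h1 _ _ _
    _ = _ := by
        simp only [Finset.sum_add_distrib]
        have e1 : ∑ a : ZMod (2 ^ R), ∑ b : ZMod (2 ^ R), f a * f b = (∑ a, f a) ^ 2 := by
          rw [sq, Finset.sum_mul_sum]
        have e2 : ∑ a : ZMod (2 ^ R), ∑ b : ZMod (2 ^ R), f a * f (-(a + b)) = (∑ a, f a) ^ 2 := by
          simp only [← Finset.mul_sum, hshift, ← Finset.sum_mul, sq]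
        have e3 : ∑ a : ZMod (2 ^ R), ∑ b : ZMod (2 ^ R), f b * f (-(a + b)) = (∑ a, f a) ^ 2 := by
          rw [Finset.sum_comm]
          simp only [← Finset.mul_sum, hshift', ← Finset.sum_mul, sq]
        rw [e1, e2, e3]
        ring

/-! ### The moment functional -/

/-- The decay rate of collision probabilities per dyadic scale. -/
noncomputable def decayRate : ℝ := Real.exp (-(0.485 * Real.log 2 ^ 2))

theorem decayRate_pos : 0 < decayRate := Real.exp_pos _

theorem decayRate_le_one : decayRate ≤ 1 := by
  rw [decayRate, Real.exp_le_one_iff]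
  nlinarith [sq_nonneg (Real.log 2)]

/-- This is the inequality `1.455 * log 2 > 1`, a form of `(3/2) log 2 > 1` with some slack given
up. It makes the sum over frequencies converge. -/
theorem two_mul_decayRate_pow_three_lt_one : 2 * decayRate ^ 3 < 1 := by
  have h := Real.log_two_gt_d9
  have : 2 * decayRate ^ 3 = Real.exp (Real.log 2 - 1.455 * Real.log 2 ^ 2) := by
    rw [Real.exp_sub, Real.exp_log two_pos, decayRate, ← Real.exp_nat_mul, div_eq_mul_inv,
      ← Real.exp_neg]
    congr 2
    push_cast; ring
  rw [this, Real.exp_lt_one_iff]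
  nlinarith

/-- Large when some dyadic tail has too few elements. -/
noncomputable def sparsity (Q R : ℕ) (c : ℕ → ℕ) : ℝ :=
  ∑ i ∈ Finset.Icc Q R, Real.exp (0.97 * (Real.log 2 / 32) * Real.log 2 * (R - i : ℕ)) *
    ∏ j ∈ Finset.Ioc ((2 : ℕ) ^ i) (2 ^ R), Real.exp (-(Real.log 2 / 32)) ^ c j

/-- Large when the total size of the elements up to `2 ^ R` is too large. -/
noncomputable def expTotal (Q R : ℕ) (c : ℕ → ℕ) : ℝ :=
  ∏ j ∈ Finset.Ioc ((2 : ℕ) ^ Q) (2 ^ R), Real.exp (j / (2 ^ R : ℕ)) ^ c j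

/-- The normalised size of the Fourier transform at `a`, coming from the elements beyond the scale
of `a`. -/
noncomputable def tailCosProd (Q R : ℕ) (c : ℕ → ℕ) (a : ZMod (2 ^ R)) : ℝ :=
  ∏ j ∈ Finset.Ioc ((2 : ℕ) ^ (R - truncLevel Q R a)) (2 ^ R),
    (2 * Real.cos (Real.pi * j * a.val / (2 ^ R : ℕ)) ^ 2) ^ c j

/-- A bound for the normalised collision energy of the subset sums. -/
noncomputable def energyBound (Q R : ℕ) (c : Fin 3 → ℕ → ℕ) : ℝ :=
  ∑ q : ZMod (2 ^ R) × ZMod (2 ^ R),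
    decayRate ^ (2 * (truncLevel Q R q.1 + truncLevel Q R q.2 + truncLevel Q R (-(q.1 + q.2)))) *
      ∏ t, tailCosProd Q R (c t) (![q.1, q.2, -(q.1 + q.2)] t)

theorem truncLevel_le (Q R : ℕ) (a : ZMod (2 ^ R)) : truncLevel Q R a ≤ R - Q := min_le_right _ _

theorem sparsity_nonneg (Q R : ℕ) (c : ℕ → ℕ) : 0 ≤ sparsity Q R c := by
  unfold sparsity; positivity

theorem expTotal_nonneg (Q R : ℕ) (c : ℕ → ℕ) : 0 ≤ expTotal Q R c := by
  unfold expTotal; positivity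

theorem tailCosProd_nonneg (Q R : ℕ) (c : ℕ → ℕ) (a : ZMod (2 ^ R)) : 0 ≤ tailCosProd Q R c a := by
  unfold tailCosProd; positivity

theorem energyBound_nonneg (Q R : ℕ) (c : Fin 3 → ℕ → ℕ) : 0 ≤ energyBound Q R c :=
  Finset.sum_nonneg fun _ _ => mul_nonneg (pow_nonneg decayRate_pos.le _)
    (Finset.prod_nonneg fun _ _ => tailCosProd_nonneg _ _ _ _)

theorem cosProd_nonneg (M : ℕ) (I : Finset ℕ) (c : ℕ → ℕ) (a : ZMod M) : 0 ≤ cosProd M I c a := by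
  unfold cosProd; positivity

theorem cosProd_anti (M : ℕ) {I J : Finset ℕ} (hIJ : J ⊆ I) (c : ℕ → ℕ) (a : ZMod M) :
    cosProd M I c a ≤ cosProd M J c a := by
  classical
  rw [cosProd, ← Finset.prod_sdiff hIJ]
  refine mul_le_of_le_one_left (cosProd_nonneg _ _ _ _) ?_
  refine Finset.prod_le_one (fun j _ => by positivity) fun j _ => pow_le_one₀ (by positivity) ?_
  exact Real.cos_sq_le_one _

/-- Keep only the lengths beyond `2 ^ (R - e)` and write `cos² = ½ · 2cos²`. The halves multiply to
`N ^ 32`, and the term `i = R - e` of `sparsity` bounds `N`. -/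
theorem cosProd_le_of_sparsity_le {Q R : ℕ} (hQR : Q ≤ R) {c : ℕ → ℕ} {A : ℝ}
    (hA : sparsity Q R c ≤ A) (a : ZMod (2 ^ R)) :
    cosProd (2 ^ R) (Finset.Ioc ((2 : ℕ) ^ Q) (2 ^ R)) c a ≤
      A ^ 32 * decayRate ^ (2 * truncLevel Q R a) * tailCosProd Q R c a := by
  have he := truncLevel_le Q R a
  set e := truncLevel Q R a with hedef
  have hsub : Finset.Ioc ((2 : ℕ) ^ (R - e)) (2 ^ R) ⊆ Finset.Ioc ((2 : ℕ) ^ Q) (2 ^ R) :=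
    Finset.Ioc_subset_Ioc_left (Nat.pow_le_pow_right two_pos (by omega))
  refine (cosProd_anti _ hsub c a).trans ?_
  set N := ∏ j ∈ Finset.Ioc ((2 : ℕ) ^ (R - e)) (2 ^ R), Real.exp (-(Real.log 2 / 32)) ^ c j with hN
  have h1 : cosProd (2 ^ R) (Finset.Ioc ((2 : ℕ) ^ (R - e)) (2 ^ R)) c a = N ^ 32 * tailCosProd Q R c a := by
    rw [hN, tailCosProd, ← hedef, ← Finset.prod_pow, ← Finset.prod_mul_distrib, cosProd]
    refine Finset.prod_congr rfl fun j _ => ?_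
    have h2 : Real.exp (-(Real.log 2 / 32)) ^ 32 = 1 / 2 := by
      rw [← Real.exp_nat_mul]
      push_cast
      rw [show (32 : ℝ) * -(Real.log 2 / 32) = -Real.log 2 by ring, Real.exp_neg, Real.exp_log two_pos]
      norm_num
    rw [pow_right_comm (Real.exp (-(Real.log 2 / 32))), h2, ← mul_pow]
    congr 1
    ring
  have h3 : Real.exp (0.97 * (Real.log 2 / 32) * Real.log 2 * e) * N ≤ A := by
    refine le_trans ?_ hA
    have := Finset.single_le_sum (f := fun i : ℕ =>
      Real.exp (0.97 * (Real.log 2 / 32) * Real.log 2 * (R - i : ℕ)) *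
      ∏ j ∈ Finset.Ioc ((2 : ℕ) ^ i) (2 ^ R), Real.exp (-(Real.log 2 / 32)) ^ c j)
      (fun i _ => by positivity) (Finset.mem_Icc.2 (⟨by omega, by omega⟩ : Q ≤ R - e ∧ R - e ≤ R))
    simp only [show R - (R - e) = e by omega] at this
    exact this
  have h4 : N ^ 32 ≤ A ^ 32 * decayRate ^ (2 * e) := by
    have h5 := pow_le_pow_left₀ (by positivity) h3 32
    have h6 : decayRate ^ (2 * e) * Real.exp (0.97 * (Real.log 2 / 32) * Real.log 2 * e) ^ 32 = 1 := by
      rw [decayRate, ← Real.exp_nat_mul, ← Real.exp_nat_mul, ← Real.exp_add, Real.exp_eq_one_iff]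
      push_cast; ring
    rw [mul_pow] at h5
    calc N ^ 32 = decayRate ^ (2 * e) *
          (Real.exp (0.97 * (Real.log 2 / 32) * Real.log 2 * e) ^ 32 * N ^ 32) := by
          rw [← mul_assoc, h6, one_mul]
      _ ≤ decayRate ^ (2 * e) * A ^ 32 := mul_le_mul_of_nonneg_left h5 (pow_nonneg decayRate_pos.le _)
      _ = _ := mul_comm _ _
  rw [h1]
  exact mul_le_mul_of_nonneg_right h4 (tailCosProd_nonneg _ _ _ _)

/-- The exponent is `97 = 3 * 32 + 1`: a factor `A ^ 32` for each permutation and one `A` from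
`energyBound`. -/
theorem sum_cosProd_le {Q R : ℕ} (hQR : Q ≤ R) {c : Fin 3 → ℕ → ℕ} {A : ℝ}
    (hA : ∀ t, sparsity Q R (c t) ≤ A) (hE : energyBound Q R c ≤ A) :
    ∑ a : ZMod (2 ^ R), ∑ b : ZMod (2 ^ R),
      cosProd (2 ^ R) (Finset.Ioc ((2 : ℕ) ^ Q) (2 ^ R)) (c 0) a *
      cosProd (2 ^ R) (Finset.Ioc ((2 : ℕ) ^ Q) (2 ^ R)) (c 1) b *
      cosProd (2 ^ R) (Finset.Ioc ((2 : ℕ) ^ Q) (2 ^ R)) (c 2) (-(a + b)) ≤ A ^ 97 := by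
  rw [← Fintype.sum_prod_type' (f := fun a b : ZMod (2 ^ R) =>
      cosProd (2 ^ R) (Finset.Ioc ((2 : ℕ) ^ Q) (2 ^ R)) (c 0) a *
      cosProd (2 ^ R) (Finset.Ioc ((2 : ℕ) ^ Q) (2 ^ R)) (c 1) b *
      cosProd (2 ^ R) (Finset.Ioc ((2 : ℕ) ^ Q) (2 ^ R)) (c 2) (-(a + b)))]
  calc _ ≤ A ^ 96 * energyBound Q R c := by
        rw [energyBound, Finset.mul_sum]
        refine Finset.sum_le_sum fun q _ => ?_
        have h0 := cosProd_le_of_sparsity_le hQR (hA 0) q.1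
        have h1 := cosProd_le_of_sparsity_le hQR (hA 1) q.2
        have h2 := cosProd_le_of_sparsity_le hQR (hA 2) (-(q.1 + q.2))
        have p1 : 0 ≤ A ^ 32 * decayRate ^ (2 * truncLevel Q R q.1) * tailCosProd Q R (c 0) q.1 :=
          (cosProd_nonneg _ _ _ _).trans h0
        have p2 : 0 ≤ A ^ 32 * decayRate ^ (2 * truncLevel Q R q.2) * tailCosProd Q R (c 1) q.2 :=
          (cosProd_nonneg _ _ _ _).trans h1
        refine (mul_le_mul (mul_le_mul h0 h1 (cosProd_nonneg _ _ _ _) p1) h2 (cosProd_nonneg _ _ _ _)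
          (mul_nonneg p1 p2)).trans (le_of_eq ?_)
        rw [Fin.prod_univ_three]
        simp only [Matrix.cons_val_zero, Matrix.cons_val_one, Matrix.cons_val]
        rw [mul_add, mul_add, pow_add, pow_add]
        ring
    _ ≤ A ^ 96 * A := mul_le_mul_of_nonneg_left hE (by positivity)
    _ = A ^ 97 := by ring

/-- `expTotal` is the exponential of the total size divided by `2 ^ R`, and `exp x ≥ x`. -/
theorem IsSubsum.le_of_expTotal_le {Q R s : ℕ} {c : ℕ → ℕ} {D : ℕ}
    (hs : IsSubsum (Finset.Ioc ((2 : ℕ) ^ Q) (2 ^ R)) c s) (hA : expTotal Q R c ≤ D) : s ≤ D * 2 ^ R := by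
  obtain ⟨m, hm, rfl⟩ := hs
  have h1 : expTotal Q R c = Real.exp ((∑ j ∈ Finset.Ioc ((2 : ℕ) ^ Q) (2 ^ R), j * c j : ℕ) / (2 ^ R : ℕ)) := by
    rw [expTotal]
    push_cast
    rw [Finset.sum_div, Real.exp_sum]
    refine Finset.prod_congr rfl fun j _ => ?_
    rw [← Real.exp_nat_mul]
    congr 1; ring
  have h2 : ((∑ j ∈ Finset.Ioc ((2 : ℕ) ^ Q) (2 ^ R), j * c j : ℕ) : ℝ) / (2 ^ R : ℕ) ≤ D := by
    rw [h1] at hA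
    linarith [Real.add_one_le_exp (((∑ j ∈ Finset.Ioc ((2 : ℕ) ^ Q) (2 ^ R), j * c j : ℕ) : ℝ) / (2 ^ R : ℕ))]
  rw [div_le_iff₀ (by positivity)] at h2
  have h3 : ∑ j ∈ Finset.Ioc ((2 : ℕ) ^ Q) (2 ^ R), j * c j ≤ D * 2 ^ R := by exact_mod_cast h2
  exact (Finset.sum_le_sum fun j hj => Nat.mul_le_mul_left j (hm j hj)).trans h3

/-- There are many triples of cycle lengths completing subset sums to a common value. -/
theorem exists_completing_triples {Q R D : ℕ} (hQR : Q ≤ R) {c : Fin 3 → ℕ → ℕ}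
    (hA : ∀ t, sparsity Q R (c t) ≤ D) (hE : energyBound Q R c ≤ D) (hV : ∀ t, expTotal Q R (c t) ≤ D) :
    ∃ T : Finset (Fin 3 → ℕ), (∀ x ∈ T, (∀ t, x t ∈ Finset.Ioc ((2 : ℕ) ^ R) ((D + 2) * 2 ^ R)) ∧
      ∃ (s : Fin 3 → ℕ) (u : ℕ), ∀ t, IsSubsum (Finset.Ioc ((2 : ℕ) ^ Q) (2 ^ R)) (c t) (s t) ∧ x t + s t = u) ∧
      ((2 ^ R : ℕ) : ℝ) ^ 3 ≤ T.card * (D : ℝ) ^ 97 := by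
  classical
  obtain ⟨S, hS, hcard⟩ := exists_subsum_differences (2 ^ R) (Finset.Ioc ((2 : ℕ) ^ Q) (2 ^ R)) c
  have hsum := sum_cosProd_le hQR hA hE
  choose! s hs using hS
  have hle : ∀ q ∈ S, ∀ t, s q t ≤ D * 2 ^ R := fun q hq t => ((hs q hq).1 t).le_of_expTotal_le (hV t)
  have hpos : 0 < 2 ^ R := by positivity
  -- The common value is `(D + 1) * 2 ^ R + 1 + w` with `0 ≤ w < 2 ^ R`. As subset sums are at most
  -- `D * 2 ^ R`, the completing lengths land in `(2 ^ R, (D + 2) * 2 ^ R]`.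
  set f : (ZMod (2 ^ R) × ZMod (2 ^ R)) × ℕ → Fin 3 → ℕ :=
    fun p t => (D + 1) * 2 ^ R + 1 + p.2 - s p.1 t with hf
  have hadd : ∀ p ∈ S ×ˢ Finset.range (2 ^ R), ∀ t, f p t + s p.1 t = (D + 1) * 2 ^ R + 1 + p.2 := by
    intro p hp t
    have := hle p.1 (Finset.mem_product.1 hp).1 t
    rw [hf]
    simp only
    rw [add_mul]
    omega
  refine ⟨(S ×ˢ Finset.range (2 ^ R)).image f, ?_, ?_⟩
  · intro x hx
    obtain ⟨p, hp, rfl⟩ := Finset.mem_image.1 hx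
    have hp1 := (Finset.mem_product.1 hp).1
    have hp2 := Finset.mem_range.1 (Finset.mem_product.1 hp).2
    refine ⟨fun t => ?_, s p.1, _, fun t => ⟨(hs p.1 hp1).1 t, hadd p hp t⟩⟩
    have h1 := hadd p hp t
    have h2 := hle p.1 hp1 t
    rw [Finset.mem_Ioc]
    rw [add_mul] at h1 ⊢
    constructor <;> omega
  -- Differences of the completing lengths modulo `2 ^ R` recover the pair in `S`, and then the
  -- common value recovers `w`.
  · have hinj : Set.InjOn f (S ×ˢ Finset.range (2 ^ R) : Finset _) := by
      intro p hp q hq hpq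
      have hp1 := (Finset.mem_product.1 hp).1
      have hq1 := (Finset.mem_product.1 hq).1
      have hcast : ∀ p ∈ S ×ˢ Finset.range (2 ^ R), ∀ t t' : Fin 3,
          (s p.1 t : ZMod (2 ^ R)) - s p.1 t' = (f p t' : ZMod (2 ^ R)) - f p t := by
        intro p hp t t'
        have h1 := hadd p hp t
        have h2 := hadd p hp t'
        have h3 : ((f p t + s p.1 t : ℕ) : ZMod (2 ^ R)) = ((f p t' + s p.1 t' : ℕ) : ZMod (2 ^ R)) := by
          rw [h1, h2]
        push_cast at h3
        linear_combination h3
      have e1 : p.1 = q.1 := by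
        refine Prod.ext ?_ ?_
        · rw [(hs p.1 hp1).2.1, (hs q.1 hq1).2.1, hcast p hp, hcast q hq, hpq]
        · rw [(hs p.1 hp1).2.2, (hs q.1 hq1).2.2, hcast p hp, hcast q hq, hpq]
      refine Prod.ext e1 ?_
      have h1 := hadd p hp 0
      have h2 := hadd q hq 0
      rw [hpq, e1] at h1
      omega
    rw [Finset.card_image_of_injOn hinj, Finset.card_product, Finset.card_range]
    have h1 : ((2 ^ R : ℕ) : ℝ) ^ 2 ≤ S.card * (D : ℝ) ^ 97 :=
      hcard.trans (mul_le_mul_of_nonneg_left hsum (Nat.cast_nonneg _))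
    have h2 : (0 : ℝ) ≤ ((2 ^ R : ℕ) : ℝ) := Nat.cast_nonneg _
    calc ((2 ^ R : ℕ) : ℝ) ^ 3 = ((2 ^ R : ℕ) : ℝ) ^ 2 * ((2 ^ R : ℕ) : ℝ) := by ring
      _ ≤ (S.card * (D : ℝ) ^ 97) * ((2 ^ R : ℕ) : ℝ) := mul_le_mul_of_nonneg_right h1 h2
      _ = _ := by rw [Nat.cast_mul]; ring

/-! ### Moments of the functionals under the Poisson law -/

theorem sum_Icc_pow_le {r : ℝ} (h0 : 0 ≤ r) (h1 : r < 1) (Q R : ℕ) :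
    ∑ i ∈ Finset.Icc Q R, r ^ (R - i) ≤ 1 / (1 - r) := by
  calc ∑ i ∈ Finset.Icc Q R, r ^ (R - i) ≤ ∑ i ∈ Finset.range (R + 1), r ^ (R - i) := by
        refine Finset.sum_le_sum_of_subset_of_nonneg (fun i hi => ?_) fun _ _ _ => by positivity
        exact Finset.mem_range.2 (Nat.lt_succ_of_le (Finset.mem_Icc.1 hi).2)
    _ = ∑ i ∈ Finset.range (R + 1), r ^ i := by
        rw [← Finset.sum_range_reflect (fun i => r ^ i)]
        exact Finset.sum_congr rfl fun i _ => by congr 1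
    _ ≤ 1 / (1 - r) := by
        have := (summable_geometric_of_lt_one h0 h1).sum_le_tsum (Finset.range (R + 1))
          (fun _ _ => by positivity)
        rwa [tsum_geometric_of_lt_one h0 h1, ← one_div] at this

/-- A bound for the expectation of `sparsity`. -/
noncomputable def sparsityBound : ℝ :=
  Real.exp (Real.log 2 / 32 * Real.log 2) *
    (1 / (1 - Real.exp (-(0.005 * (Real.log 2 / 32) * Real.log 2))))

/-- With `s = log 2 / 32`, each term has exponent at most `s log 2 * (0.97 L - 0.975 (L - 1))`,
where `L = R - i`, so the terms decay geometrically. Taking `s` small makes `1 - exp (-s)` close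
enough to `s` to beat `0.97 s`. -/
theorem sparsity_mean_le (Q R : ℕ) :
    ∑ i ∈ Finset.Icc Q R, Real.exp (0.97 * (Real.log 2 / 32) * Real.log 2 * (R - i : ℕ)) *
      Real.exp (∑ j ∈ Finset.Ioc ((2 : ℕ) ^ i) (2 ^ R), (Real.exp (-(Real.log 2 / 32)) - 1) / j) ≤
      sparsityBound := by
  have hl0 : 0 < Real.log 2 := Real.log_pos one_lt_two
  have hl1 : Real.log 2 < 0.7 := by linarith [Real.log_two_lt_d9]
  set s := Real.log 2 / 32 with hs
  have hs0 : 0 < s := by positivity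
  have hs1 : s < 0.022 := by rw [hs]; linarith
  have hy : Real.exp (-s) - 1 ≤ -(0.975 * s) := by
    have h1 : Real.exp (-s) ≤ 1 / (1 + s) := by
      rw [Real.exp_neg, ← one_div]
      apply one_div_le_one_div_of_le (by linarith)
      linarith [Real.add_one_le_exp s]
    have h2 : 1 / (1 + s) ≤ 1 - 0.975 * s := by
      rw [div_le_iff₀ (by linarith)]
      nlinarith
    linarith
  have hy' : -s ≤ Real.exp (-s) - 1 := by linarith [Real.add_one_le_exp (-s)]
  rw [sparsityBound, ← hs]
  refine le_trans (Finset.sum_le_sum (g := fun i => Real.exp (s * Real.log 2) *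
    Real.exp (-(0.005 * s * Real.log 2)) ^ (R - i)) fun i hi => ?_) ?_
  · have hi' := (Finset.mem_Icc.1 hi).2
    rw [← Real.exp_add, ← Real.exp_nat_mul, ← Real.exp_add, Real.exp_le_exp]
    have h3 : ∑ j ∈ Finset.Ioc ((2 : ℕ) ^ i) (2 ^ R), (Real.exp (-s) - 1) / (j : ℝ) =
        (Real.exp (-s) - 1) * ∑ j ∈ Finset.Ioc ((2 : ℕ) ^ i) (2 ^ R), (1 / j : ℝ) := by
      rw [Finset.mul_sum]
      exact Finset.sum_congr rfl fun j _ => by ring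
    rw [h3]
    have h4 := mul_log_two_le_sum_inv hi'
    set H := ∑ j ∈ Finset.Ioc ((2 : ℕ) ^ i) (2 ^ R), (1 / j : ℝ)
    have h5 : (Real.exp (-s) - 1) * H ≤ (Real.exp (-s) - 1) * (((R - i : ℕ) - 1 : ℝ) * Real.log 2) :=
      mul_le_mul_of_nonpos_left h4 (by nlinarith)
    -- For `R = i` the factor `R - i - 1` is `-1`, so the lower bound `hy'` is needed instead of
    -- `hy`.
    rcases Nat.eq_zero_or_pos (R - i) with h0 | hpos
    · rw [h0] at h5 ⊢
      simp only [Nat.cast_zero] at h5 ⊢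
      nlinarith
    · have hL : (1 : ℝ) ≤ ((R - i : ℕ) : ℝ) := by exact_mod_cast hpos
      have h6 : (Real.exp (-s) - 1) * (((R - i : ℕ) - 1 : ℝ) * Real.log 2) ≤
          -(0.975 * s) * (((R - i : ℕ) - 1 : ℝ) * Real.log 2) :=
        mul_le_mul_of_nonneg_right hy (mul_nonneg (by linarith) hl0.le)
      have h7 : 0 < s * Real.log 2 := by positivity
      nlinarith
  · rw [← Finset.mul_sum]
    refine mul_le_mul_of_nonneg_left (sum_Icc_pow_le (Real.exp_pos _).le ?_ Q R) (Real.exp_pos _).le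
    rw [Real.exp_lt_one_iff]
    have : 0 < 0.005 * s * Real.log 2 := by positivity
    linarith

theorem expTotal_mean_le (Q R : ℕ) :
    Real.exp (∑ j ∈ Finset.Ioc ((2 : ℕ) ^ Q) (2 ^ R), (Real.exp (j / (2 ^ R : ℕ)) - 1) / j) ≤ Real.exp 2 := by
  rw [Real.exp_le_exp]
  have hR : (0 : ℝ) < (2 ^ R : ℕ) := by positivity
  calc ∑ j ∈ Finset.Ioc ((2 : ℕ) ^ Q) (2 ^ R), (Real.exp (j / (2 ^ R : ℕ)) - 1) / j
      ≤ ∑ _j ∈ Finset.Ioc ((2 : ℕ) ^ Q) (2 ^ R), 2 / ((2 ^ R : ℕ) : ℝ) := by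
        refine Finset.sum_le_sum fun j hj => ?_
        have hj' := Finset.mem_Ioc.1 hj
        have hj0 : (0 : ℝ) < j := by exact_mod_cast (Nat.zero_le _).trans_lt hj'.1
        have h1 : |(j : ℝ) / (2 ^ R : ℕ)| ≤ 1 := by
          rw [abs_of_nonneg (by positivity), div_le_one hR]
          exact_mod_cast hj'.2
        have h2 := Real.abs_exp_sub_one_le h1
        rw [abs_of_nonneg (by positivity : (0 : ℝ) ≤ (j : ℝ) / (2 ^ R : ℕ))] at h2
        rw [div_le_iff₀ hj0]
        calc _ ≤ 2 * ((j : ℝ) / (2 ^ R : ℕ)) := (le_abs_self _).trans h2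
          _ = _ := by ring
    _ ≤ 2 := by
        rw [Finset.sum_const, Nat.card_Ioc, nsmul_eq_mul]
        have : ((2 ^ R - 2 ^ Q : ℕ) : ℝ) ≤ (2 ^ R : ℕ) := by exact_mod_cast Nat.sub_le _ _
        rw [mul_div_assoc', div_le_iff₀ hR]
        linarith

/-- The lengths start at `2 ^ (R - e)`, at least `2 ^ R` divided by the distance from `a` to `0`,
which is the range where the cosine sum is bounded. At level `0` the range is empty. -/
theorem tailCosProd_mean_le (Q R : ℕ) (a : ZMod (2 ^ R)) :
    ∑ j ∈ Finset.Ioc ((2 : ℕ) ^ (R - truncLevel Q R a)) (2 ^ R),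
      (2 * Real.cos (Real.pi * j * a.val / (2 ^ R : ℕ)) ^ 2 - 1) / j ≤ 1 / 2 := by
  have hle : truncLevel Q R a ≤ freqLevel R a := min_le_left _ _
  rcases Nat.eq_zero_or_pos (freqLevel R a) with h0 | hpos
  · have : truncLevel Q R a = 0 := by omega
    rw [this]
    simp
  · have hm : min a.val (2 ^ R - a.val) ≠ 0 := by
      intro h
      rw [freqLevel, h] at hpos
      simp at hpos
    have hl := Nat.pow_log_le_self 2 hm
    refine sum_two_cos_sq_sub_one_div_le (by positivity) a.val_lt ?_
      (Nat.pow_le_pow_right two_pos (Nat.sub_le _ _))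
    refine le_trans ?_ (Nat.mul_le_mul_left _ hl)
    rw [← pow_add]
    apply Nat.pow_le_pow_right two_pos
    rw [freqLevel] at hle
    omega

theorem energyBound_mean_le (Q R : ℕ) :
    ∑ q : ZMod (2 ^ R) × ZMod (2 ^ R),
    decayRate ^ (2 * (truncLevel Q R q.1 + truncLevel Q R q.2 + truncLevel Q R (-(q.1 + q.2)))) *
      Real.exp (∑ t : Fin 3, ∑ j ∈ Finset.Ioc ((2 : ℕ) ^ (R - truncLevel Q R (![q.1, q.2, -(q.1 + q.2)] t))) (2 ^ R),
        (2 * Real.cos (Real.pi * j * (![q.1, q.2, -(q.1 + q.2)] t).val / (2 ^ R : ℕ)) ^ 2 - 1) / j) ≤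
    3 * (4 / (1 - 2 * decayRate ^ 3) + 2 ^ R * (decayRate ^ 3) ^ (R - Q)) ^ 2 * Real.exp (3 / 2) := by
  have h3 : 0 ≤ decayRate ^ 3 := pow_nonneg decayRate_pos.le _
  calc _ ≤ ∑ q : ZMod (2 ^ R) × ZMod (2 ^ R),
      decayRate ^ (2 * (truncLevel Q R q.1 + truncLevel Q R q.2 + truncLevel Q R (-(q.1 + q.2)))) *
        Real.exp (3 / 2) := by
        refine Finset.sum_le_sum fun q _ => mul_le_mul_of_nonneg_left ?_ (pow_nonneg decayRate_pos.le _)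
        rw [Real.exp_le_exp]
        refine (Finset.sum_le_sum fun t _ => tailCosProd_mean_le Q R _).trans ?_
        simp; norm_num
    _ ≤ _ := by
        rw [← Finset.sum_mul]
        refine mul_le_mul_of_nonneg_right ?_ (Real.exp_pos _).le
        rw [Fintype.sum_prod_type]
        refine (sum_sum_pow_truncLevel_le decayRate_pos.le decayRate_le_one Q R).trans ?_
        refine mul_le_mul_of_nonneg_left (pow_le_pow_left₀ ?_ ?_ 2) (by norm_num)
        · exact Finset.sum_nonneg fun _ _ => pow_nonneg h3 _
        · exact sum_pow_truncLevel_le h3 two_mul_decayRate_pow_three_lt_one Q R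

/-- Makes the cost of truncating levels at `R - Q` harmless, by taking `R` large in terms of `Q`. -/
theorem exists_two_pow_mul_decayRate_le_one (Q : ℕ) :
    ∃ R, Q < R ∧ 2 ^ R * (decayRate ^ 3) ^ (R - Q) ≤ 1 := by
  have h3 : 0 < decayRate ^ 3 := pow_pos decayRate_pos _
  have ht := tendsto_pow_atTop_nhds_zero_of_lt_one (r := 2 * decayRate ^ 3) (by positivity)
    two_mul_decayRate_pow_three_lt_one
  obtain ⟨R, hR, hQ⟩ := ((ht.eventually (gt_mem_nhds (pow_pos h3 Q))).and (eventually_gt_atTop Q)).exists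
  refine ⟨R, hQ, ?_⟩
  have h4 : (decayRate ^ 3) ^ R = (decayRate ^ 3) ^ (R - Q) * (decayRate ^ 3) ^ Q := by
    rw [← pow_add]; congr 1; omega
  rw [mul_pow, h4, ← mul_assoc] at hR
  have h5 : 0 < (decayRate ^ 3) ^ Q := pow_pos h3 _
  by_contra! hcon
  nlinarith

namespace IsPoissonFamily

open MeasureTheory ProbabilityTheory

variable {ι Ω : Type*} [MeasurableSpace Ω] {P : Measure Ω} {X : ι × ℕ → Ω → ℕ}
  (h : IsPoissonFamily P X)
include h

theorem lintegral_sum_prod_pow {κ : Type*} (s : Finset κ) {w : κ → ℝ} (hw : ∀ k ∈ s, 0 ≤ w k)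
    (A : κ → Finset (ι × ℕ)) {y : κ → ι × ℕ → ℝ} (hy : ∀ k p, 0 ≤ y k p) :
    ∫⁻ ω, ENNReal.ofReal (∑ k ∈ s, w k * ∏ p ∈ A k, y k p ^ X p ω) ∂P =
      ENNReal.ofReal (∑ k ∈ s, w k * Real.exp (∑ p ∈ A k, (y k p - 1) / p.2)) := by
  have h1 : ∀ ω, ENNReal.ofReal (∑ k ∈ s, w k * ∏ p ∈ A k, y k p ^ X p ω) =
      ∑ k ∈ s, ENNReal.ofReal (w k) * ENNReal.ofReal (∏ p ∈ A k, y k p ^ X p ω) := fun ω => by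
    rw [ENNReal.ofReal_sum_of_nonneg fun k hk => mul_nonneg (hw k hk)
      (Finset.prod_nonneg fun p _ => pow_nonneg (hy k p) _)]
    exact Finset.sum_congr rfl fun k hk => ENNReal.ofReal_mul (hw k hk)
  have h2 : ∀ k, Measurable fun ω => ENNReal.ofReal (∏ p ∈ A k, y k p ^ X p ω) := fun k => by
    have := h.measurable_of_finset (A k) fun c => ENNReal.ofReal (∏ p : A k, y k p ^ c p)
    convert this using 3 with ω
    exact (Finset.prod_coe_sort (A k) fun p => y k p ^ X p ω).symm
  simp only [h1]
  rw [lintegral_finsetSum _ fun k _ => (h2 k).const_mul _,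
    ENNReal.ofReal_sum_of_nonneg fun k hk => mul_nonneg (hw k hk) (Real.exp_pos _).le]
  refine Finset.sum_congr rfl fun k hk => ?_
  rw [lintegral_const_mul _ (h2 k), h.lintegral_prod_pow (A k) (hy k), ENNReal.ofReal_mul (hw k hk)]

theorem measurable_comp_of_dependsOn {β : Type*} [MeasurableSpace β]
    {A : Finset (ι × ℕ)} {f : (ι × ℕ → ℕ) → β} (hf : DependsOn f (A : Set (ι × ℕ))) :
    Measurable fun ω => f fun p => X p ω := by
  classical
  have := h.measurable_of_finset A fun c => f fun p => if hp : p ∈ A then c ⟨p, hp⟩ else 0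
  convert this using 2 with ω
  exact hf fun p hp => by simp [show p ∈ A from hp]

theorem lintegral_sum_prod_pow_single (t : ι) {κ : Type*} (s : Finset κ) {w : κ → ℝ}
    (hw : ∀ k ∈ s, 0 ≤ w k) (B : κ → Finset ℕ) {y : κ → ℕ → ℝ} (hy : ∀ k j, 0 ≤ y k j) :
    ∫⁻ ω, ENNReal.ofReal (∑ k ∈ s, w k * ∏ j ∈ B k, y k j ^ X (t, j) ω) ∂P =
      ENNReal.ofReal (∑ k ∈ s, w k * Real.exp (∑ j ∈ B k, (y k j - 1) / j)) := by
  have := h.lintegral_sum_prod_pow s hw (fun k => {t} ×ˢ B k) (y := fun k p => y k p.2)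
    (fun k p => hy k p.2)
  simpa only [Finset.prod_product, Finset.sum_product, Finset.prod_singleton,
    Finset.sum_singleton] using this

theorem lintegral_sum_prod_prod_pow [Fintype ι] {κ : Type*} (s : Finset κ) {w : κ → ℝ}
    (hw : ∀ k ∈ s, 0 ≤ w k) (B : κ → ι → Finset ℕ) {y : κ → ι → ℕ → ℝ} (hy : ∀ k t j, 0 ≤ y k t j) :
    ∫⁻ ω, ENNReal.ofReal (∑ k ∈ s, w k * ∏ t, ∏ j ∈ B k t, y k t j ^ X (t, j) ω) ∂P =
      ENNReal.ofReal (∑ k ∈ s, w k * Real.exp (∑ t, ∑ j ∈ B k t, (y k t j - 1) / j)) := by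
  have := h.lintegral_sum_prod_pow s hw
    (fun k => (Finset.univ.sigma (B k)).map (Equiv.sigmaEquivProd ι ℕ).toEmbedding)
    (y := fun k p => y k p.1 p.2) (fun k p => hy k p.1 p.2)
  simpa only [Finset.prod_map, Finset.sum_map, Finset.prod_sigma, Finset.sum_sigma,
    Equiv.coe_toEmbedding, Equiv.sigmaEquivProd_apply] using this

end IsPoissonFamily

section congr

variable {Q R : ℕ}

theorem sparsity_congr {c d : ℕ → ℕ} (h : ∀ j ≤ 2 ^ R, c j = d j) :
    sparsity Q R c = sparsity Q R d := by
  refine Finset.sum_congr rfl fun i _ => ?_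
  congr 1
  exact Finset.prod_congr rfl fun j hj => by rw [h j (Finset.mem_Ioc.1 hj).2]

theorem expTotal_congr {c d : ℕ → ℕ} (h : ∀ j ≤ 2 ^ R, c j = d j) :
    expTotal Q R c = expTotal Q R d :=
  Finset.prod_congr rfl fun j hj => by rw [h j (Finset.mem_Ioc.1 hj).2]

theorem energyBound_congr {c d : Fin 3 → ℕ → ℕ} (h : ∀ t, ∀ j ≤ 2 ^ R, c t j = d t j) :
    energyBound Q R c = energyBound Q R d := by
  refine Finset.sum_congr rfl fun q _ => ?_
  congr 1
  exact Finset.prod_congr rfl fun t _ => Finset.prod_congr rfl fun j hj => by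
    rw [h t j (Finset.mem_Ioc.1 hj).2]

end congr

/-- The total of the functionals controlling the subset sums. -/
noncomputable def badness (Q R : ℕ) (c : Fin 3 → ℕ → ℕ) : ℝ :=
  ∑ t, sparsity Q R (c t) + (∑ t, expTotal Q R (c t) + energyBound Q R c)

/-- A bound for the expectation of `badness`. -/
noncomputable def badnessBound : ℝ :=
  3 * sparsityBound + (3 * Real.exp 2 +
    3 * (4 / (1 - 2 * decayRate ^ 3) + 1) ^ 2 * Real.exp (3 / 2))

theorem badness_congr {Q R : ℕ} {c d : Fin 3 → ℕ → ℕ} (h : ∀ t, ∀ j ≤ 2 ^ R, c t j = d t j) :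
    badness Q R c = badness Q R d := by
  rw [badness, badness, energyBound_congr h, Finset.sum_congr rfl fun t _ => sparsity_congr (h t),
    Finset.sum_congr rfl fun t _ => expTotal_congr (h t)]

theorem sparsityBound_nonneg : 0 ≤ sparsityBound := (Finset.sum_nonneg fun _ _ => by positivity).trans
  (sparsity_mean_le 0 0)

namespace IsPoissonFamily

open MeasureTheory ProbabilityTheory

variable {Ω : Type*} [MeasurableSpace Ω] {P : Measure Ω} {X : Fin 3 × ℕ → Ω → ℕ}
  (h : IsPoissonFamily P X)
include h

theorem measurable_comp_of_eqOn {β : Type*} [MeasurableSpace β] (N : ℕ) {f : (Fin 3 → ℕ → ℕ) → β}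
    (hf : ∀ c d, (∀ t, ∀ j ≤ N, c t j = d t j) → f c = f d) :
    Measurable fun ω => f fun t j => X (t, j) ω := by
  refine h.measurable_comp_of_dependsOn (A := Finset.univ ×ˢ Finset.Icc 0 N)
    (f := fun c => f fun t j => c (t, j)) fun c d hcd => hf _ _ fun t j hj => hcd _ ?_
  simp [hj]

theorem lintegral_sparsity_le (Q R : ℕ) (t : Fin 3) :
    ∫⁻ ω, ENNReal.ofReal (sparsity Q R fun j => X (t, j) ω) ∂P ≤ ENNReal.ofReal sparsityBound := by
  simp only [sparsity]
  rw [h.lintegral_sum_prod_pow_single t (Finset.Icc Q R)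
    (w := fun i => Real.exp (0.97 * (Real.log 2 / 32) * Real.log 2 * (R - i : ℕ)))
    (fun _ _ => (Real.exp_pos _).le) (fun i => Finset.Ioc ((2 : ℕ) ^ i) (2 ^ R))
    (y := fun _ _ => Real.exp (-(Real.log 2 / 32))) (fun _ _ => (Real.exp_pos _).le)]
  exact ENNReal.ofReal_le_ofReal (sparsity_mean_le Q R)

theorem lintegral_expTotal_le (Q R : ℕ) (t : Fin 3) :
    ∫⁻ ω, ENNReal.ofReal (expTotal Q R fun j => X (t, j) ω) ∂P ≤ ENNReal.ofReal (Real.exp 2) := by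
  simp only [expTotal]
  have := h.lintegral_sum_prod_pow_single t {()} (w := fun _ => 1) (fun _ _ => zero_le_one)
    (fun _ => Finset.Ioc ((2 : ℕ) ^ Q) (2 ^ R)) (y := fun _ j => Real.exp (j / (2 ^ R : ℕ)))
    (fun _ _ => (Real.exp_pos _).le)
  simp only [Finset.sum_singleton, one_mul] at this
  rw [this]
  exact ENNReal.ofReal_le_ofReal (expTotal_mean_le Q R)

theorem lintegral_energyBound_le {Q R : ℕ} (hQR : 2 ^ R * (decayRate ^ 3) ^ (R - Q) ≤ 1) :
    ∫⁻ ω, ENNReal.ofReal (energyBound Q R fun t j => X (t, j) ω) ∂P ≤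
      ENNReal.ofReal (3 * (4 / (1 - 2 * decayRate ^ 3) + 1) ^ 2 * Real.exp (3 / 2)) := by
  simp only [energyBound, tailCosProd]
  rw [h.lintegral_sum_prod_prod_pow Finset.univ
    (w := fun q : ZMod (2 ^ R) × ZMod (2 ^ R) => decayRate ^ (2 * (truncLevel Q R q.1 +
      truncLevel Q R q.2 + truncLevel Q R (-(q.1 + q.2)))))
    (fun _ _ => pow_nonneg decayRate_pos.le _)
    (fun q t => Finset.Ioc ((2 : ℕ) ^ (R - truncLevel Q R (![q.1, q.2, -(q.1 + q.2)] t))) (2 ^ R))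
    (y := fun q t j => 2 * Real.cos (Real.pi * j * (![q.1, q.2, -(q.1 + q.2)] t).val / (2 ^ R : ℕ)) ^ 2)
    (fun _ _ _ => by positivity)]
  refine ENNReal.ofReal_le_ofReal ((energyBound_mean_le Q R).trans ?_)
  have h1 : 0 < 1 - 2 * decayRate ^ 3 := by linarith [two_mul_decayRate_pow_three_lt_one]
  have h2 : 0 < decayRate := decayRate_pos
  gcongr

theorem lintegral_badness_le {Q R : ℕ} (hQR : 2 ^ R * (decayRate ^ 3) ^ (R - Q) ≤ 1) :
    ∫⁻ ω, ENNReal.ofReal (badness Q R fun t j => X (t, j) ω) ∂P ≤ ENNReal.ofReal badnessBound := by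
  have e : ∀ ω, ENNReal.ofReal (badness Q R fun t j => X (t, j) ω) =
      ∑ t : Fin 3, ENNReal.ofReal (sparsity Q R fun j => X (t, j) ω) +
      (∑ t : Fin 3, ENNReal.ofReal (expTotal Q R fun j => X (t, j) ω) +
        ENNReal.ofReal (energyBound Q R fun t j => X (t, j) ω)) := by
    intro ω
    have n1 := fun t : Fin 3 => sparsity_nonneg Q R fun j => X (t, j) ω
    have n2 := fun t : Fin 3 => expTotal_nonneg Q R fun j => X (t, j) ω
    have n3 := energyBound_nonneg Q R fun t j => X (t, j) ω
    rw [badness, ENNReal.ofReal_add (Finset.sum_nonneg fun t _ => n1 t)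
      (add_nonneg (Finset.sum_nonneg fun t _ => n2 t) n3), ENNReal.ofReal_add
      (Finset.sum_nonneg fun t _ => n2 t) n3, ENNReal.ofReal_sum_of_nonneg fun t _ => n1 t,
      ENNReal.ofReal_sum_of_nonneg fun t _ => n2 t]
  have m1 : ∀ t : Fin 3, Measurable fun ω => ENNReal.ofReal (sparsity Q R fun j => X (t, j) ω) := fun t =>
    h.measurable_comp_of_eqOn (2 ^ R) (f := fun c => ENNReal.ofReal (sparsity Q R (c t)))
      fun c d hcd => by rw [sparsity_congr (hcd t)]
  have m2 : ∀ t : Fin 3, Measurable fun ω => ENNReal.ofReal (expTotal Q R fun j => X (t, j) ω) := fun t =>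
    h.measurable_comp_of_eqOn (2 ^ R) (f := fun c => ENNReal.ofReal (expTotal Q R (c t)))
      fun c d hcd => by rw [expTotal_congr (hcd t)]
  simp only [e]
  rw [lintegral_add_left (Finset.measurable_sum _ fun t _ => m1 t),
    lintegral_add_left (Finset.measurable_sum _ fun t _ => m2 t),
    lintegral_finsetSum _ fun t _ => m1 t, lintegral_finsetSum _ fun t _ => m2 t]
  have b1 := sparsityBound_nonneg
  have h1 : 0 < 1 - 2 * decayRate ^ 3 := by linarith [two_mul_decayRate_pow_three_lt_one]
  rw [badnessBound, ENNReal.ofReal_add (by positivity) (by positivity), ENNReal.ofReal_add (by positivity)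
    (by positivity)]
  have three : ∀ x : ℝ, ENNReal.ofReal (3 * x) = ∑ _t : Fin 3, ENNReal.ofReal x := by
    intro x
    rw [Finset.sum_const, Finset.card_univ, Fintype.card_fin, nsmul_eq_mul, ENNReal.ofReal_mul (by norm_num)]
    norm_num
  rw [three, three]
  exact add_le_add (Finset.sum_le_sum fun t _ => h.lintegral_sparsity_le Q R t)
    (add_le_add (Finset.sum_le_sum fun t _ => h.lintegral_expTotal_le Q R t)
      (h.lintegral_energyBound_le hQR))

/-- Markov's inequality; the bound on the mean depends on neither `Q` nor `R`. -/
theorem measure_badness_le {Q R : ℕ} (hQR : 2 ^ R * (decayRate ^ 3) ^ (R - Q) ≤ 1) {A : ℝ} (hA0 : 0 < A)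
    (hA : 2 * badnessBound ≤ A) :
    1 / 2 ≤ P {ω | badness Q R (fun t j => X (t, j) ω) ≤ A} := by
  have hP := h.isProbabilityMeasure
  have hm : Measurable fun ω => badness Q R fun t j => X (t, j) ω :=
    h.measurable_comp_of_eqOn (2 ^ R) fun c d hcd => badness_congr hcd
  have h1 := mul_meas_ge_le_lintegral (μ := P) hm.ennreal_ofReal (ENNReal.ofReal A)
  have h2 : ENNReal.ofReal A * P {ω | ENNReal.ofReal A ≤
      ENNReal.ofReal (badness Q R fun t j => X (t, j) ω)} ≤ ENNReal.ofReal A * (1 / 2) := by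
    refine (h1.trans (h.lintegral_badness_le hQR)).trans ?_
    have : (1 / 2 : ENNReal) = ENNReal.ofReal (1 / 2) := by
      rw [ENNReal.ofReal_div_of_pos two_pos]; simp
    rw [this, ← ENNReal.ofReal_mul hA0.le]
    exact ENNReal.ofReal_le_ofReal (by linarith)
  have h3 : P {ω | A ≤ badness Q R fun t j => X (t, j) ω} ≤ 1 / 2 := by
    refine le_trans (measure_mono fun ω hω => ENNReal.ofReal_le_ofReal hω) ?_
    exact (ENNReal.mul_le_mul_iff_right (by simpa using hA0) ENNReal.ofReal_ne_top).1 h2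
  have h4 : {ω | badness Q R (fun t j => X (t, j) ω) ≤ A}ᶜ ⊆
      {ω | A ≤ badness Q R fun t j => X (t, j) ω} := fun ω hω => by
    simp only [Set.mem_compl_iff, Set.mem_ofPred_eq, not_le] at hω
    exact hω.le
  have hms : MeasurableSet {ω | badness Q R (fun t j => X (t, j) ω) ≤ A} := hm measurableSet_Iic
  have h5 := prob_compl_eq_one_sub (μ := P) hms.compl
  rw [compl_compl] at h5
  rw [h5]
  have h6 : (1 / 2 : ENNReal) = 1 - 1 / 2 := by
    rw [one_div, ENNReal.one_sub_inv_two]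
  rw [h6]
  exact tsub_le_tsub_left ((measure_mono h4).trans h3) 1

end IsPoissonFamily

/-! ### Common subset sums -/

theorem IsSubsum.congr {I : Finset ℕ} {c d : ℕ → ℕ} {s : ℕ} (h : IsSubsum I c s)
    (hcd : ∀ j ∈ I, c j = d j) : IsSubsum I d s := by
  obtain ⟨m, hm, hs⟩ := h
  exact ⟨m, fun j hj => hcd j hj ▸ hm j hj, hs⟩

theorem IsSubsum.mono {I K : Finset ℕ} {c : ℕ → ℕ} {s : ℕ} (h : IsSubsum I c s) (hIK : I ⊆ K) :
    IsSubsum K c s := by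
  classical
  obtain ⟨m, hm, rfl⟩ := h
  refine ⟨fun j => if j ∈ I then m j else 0, fun j _ => ?_, ?_⟩
  · simp only
    split_ifs with hj
    · exact hm j hj
    · exact Nat.zero_le _
  · simp only [mul_ite, mul_zero, Finset.sum_ite_mem, Finset.inter_eq_right.2 hIK]

theorem IsSubsum.union {I J : Finset ℕ} {c : ℕ → ℕ} {s s' : ℕ} (h : IsSubsum I c s)
    (h' : IsSubsum J c s') (hIJ : Disjoint I J) : IsSubsum (I ∪ J) c (s + s') := by
  classical
  obtain ⟨m, hm, rfl⟩ := h
  obtain ⟨m', hm', rfl⟩ := h'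
  refine ⟨fun j => if j ∈ I then m j else m' j, fun j hj => ?_, ?_⟩
  · simp only
    split_ifs with hjI
    · exact hm j hjI
    · exact hm' j ((Finset.mem_union.1 hj).resolve_left hjI)
  · rw [Finset.sum_union hIJ]
    congr 1
    · exact Finset.sum_congr rfl fun j hj => by simp only [if_pos hj]
    · exact Finset.sum_congr rfl fun j hj => by simp only [if_neg (Finset.disjoint_right.1 hIJ hj)]

theorem isSubsum_singleton {c : ℕ → ℕ} {x : ℕ} (hx : 1 ≤ c x) : IsSubsum {x} c x :=
  ⟨fun _ => 1, fun j hj => by rwa [Finset.mem_singleton.1 hj], by simp⟩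

/-- The counts `c t` have a common positive subset sum from cycle lengths in `I`. -/
def HasCommonSubsum {r : ℕ} (I : Finset ℕ) (c : Fin r → ℕ → ℕ) : Prop :=
  ∃ u : ℕ, 0 < u ∧ ∀ t, IsSubsum I (c t) u

theorem HasCommonSubsum.congr {r : ℕ} {I : Finset ℕ} {c d : Fin r → ℕ → ℕ} (h : HasCommonSubsum I c)
    (hcd : ∀ t, ∀ j ∈ I, c t j = d t j) : HasCommonSubsum I d := by
  obtain ⟨u, hu, h⟩ := h
  exact ⟨u, hu, fun t => (h t).congr (hcd t)⟩

theorem HasCommonSubsum.mono {r : ℕ} {I K : Finset ℕ} {c : Fin r → ℕ → ℕ} (h : HasCommonSubsum I c)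
    (hIK : I ⊆ K) : HasCommonSubsum K c := by
  obtain ⟨u, hu, h⟩ := h
  exact ⟨u, hu, fun t => (h t).mono hIK⟩

namespace IsPoissonFamily

open MeasureTheory ProbabilityTheory

variable {Ω : Type*} [MeasurableSpace Ω] {P : Measure Ω} {X : Fin 3 × ℕ → Ω → ℕ}
  (h : IsPoissonFamily P X)
include h

/-- For `x ∈ T` consider the event that, for each `t`, the only length in the range is `x t`,
occurring once. These events are disjoint, so no second moment is needed, and each has probability
at least a constant times `M ^ (-3)`. -/
theorem measure_exists_mem_le {M D : ℕ} (hM : 0 < M) {T : Finset (Fin 3 → ℕ)}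
    (hT : ∀ x ∈ T, ∀ t, x t ∈ Finset.Ioc M ((D + 2) * M)) :
    ENNReal.ofReal (T.card * (Real.exp (-(D + 1)) / ((D + 2) * M)) ^ 3) ≤
      P {ω | ∃ x ∈ T, ∀ t, 1 ≤ X (t, x t) ω} := by
  classical
  set J := Finset.Ioc M ((D + 2) * M) with hJ
  set A : Finset (Fin 3 × ℕ) := Finset.univ ×ˢ J with hA
  set E : (Fin 3 → ℕ) → Set Ω := fun x => {ω | ∀ p ∈ A, X p ω = if p.2 = x p.1 then 1 else 0} with hE
  have hsub : (⋃ x ∈ T, E x) ⊆ {ω | ∃ x ∈ T, ∀ t, 1 ≤ X (t, x t) ω} := by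
    intro ω hω
    simp only [Set.mem_iUnion] at hω
    obtain ⟨x, hx, hω⟩ := hω
    refine ⟨x, hx, fun t => ?_⟩
    rw [hω (t, x t) (by simpa [hA] using hT x hx t)]
    simp
  have hmeas : ∀ x ∈ T, MeasurableSet (E x) := by
    intro x _
    have : E x = ⋂ p ∈ A, X p ⁻¹' {if p.2 = x p.1 then 1 else 0} := by ext; simp [hE]
    rw [this]
    exact Finset.measurableSet_biInter _ fun p _ => h.measurable p (measurableSet_singleton _)
  have hdisj : (T : Set (Fin 3 → ℕ)).PairwiseDisjoint E := by
    intro x hx y hy hxy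
    rw [Function.onFun, Set.disjoint_left]
    intro ω hωx hωy
    apply hxy
    funext t
    have h1 := hωx (t, x t) (by simpa [hA] using hT x hx t)
    have h2 := hωy (t, x t) (by simpa [hA] using hT x hx t)
    rw [h1] at h2
    by_contra hne
    simp [hne] at h2
  have hH : ∑ j ∈ J, (1 / j : ℝ) ≤ D + 1 := by
    have := sum_inv_Ioc_le M (D + 1)
    push_cast at this
    exact this
  have hprob : ∀ x ∈ T, ENNReal.ofReal ((Real.exp (-(D + 1)) / ((D + 2) * M)) ^ 3) ≤ P (E x) := by
    intro x hx
    rw [hE, h.measure_forall_eq A]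
    apply ENNReal.ofReal_le_ofReal
    rw [hA, Finset.prod_product, ← Fin.prod_const]
    refine Finset.prod_le_prod (fun _ _ => by positivity) fun t _ => ?_
    simp only
    rw [Finset.prod_mul_distrib, ← Real.exp_sum, Finset.sum_neg_distrib, div_eq_mul_inv]
    have hxt := hT x hx t
    have h1 : ∏ j ∈ J, cycleWeight j (if j = x t then 1 else 0) = (x t : ℝ)⁻¹ := by
      rw [Finset.prod_eq_single (x t)]
      · simp [cycleWeight]
      · intro j _ hj
        rw [if_neg hj, cycleWeight_zero]
      · exact fun hn => absurd hxt hn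
    rw [h1]
    have h2 := Finset.mem_Ioc.1 hxt
    have h3 : (0 : ℝ) < x t := by exact_mod_cast (Nat.zero_le _).trans_lt h2.1
    refine mul_le_mul (Real.exp_le_exp.2 (by linarith)) ?_ (by positivity) (Real.exp_pos _).le
    apply inv_anti₀ h3
    exact_mod_cast h2.2
  calc ENNReal.ofReal (T.card * (Real.exp (-(D + 1)) / ((D + 2) * M)) ^ 3)
      = ∑ _x ∈ T, ENNReal.ofReal ((Real.exp (-(D + 1)) / ((D + 2) * M)) ^ 3) := by
        rw [Finset.sum_const, nsmul_eq_mul, ENNReal.ofReal_mul (Nat.cast_nonneg _), ENNReal.ofReal_natCast]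
    _ ≤ ∑ x ∈ T, P (E x) := Finset.sum_le_sum hprob
    _ = P (⋃ x ∈ T, E x) := (measure_biUnion_finset hdisj hmeas).symm
    _ ≤ _ := measure_mono hsub

/-- The lengths up to `2 ^ R` are good with probability at least `1 / 2`. Given them, at least a
constant times `M ^ 3` triples of longer lengths complete a common sum, where `M = 2 ^ R`, and the
powers of `M` cancel. Hence `δ` does not depend on `Q`. -/
theorem exists_measure_hasCommonSubsum_ge :
    ∃ δ : ENNReal, 0 < δ ∧ ∀ Q, ∃ R, Q < R ∧
      δ ≤ P {ω | HasCommonSubsum (Finset.Ioc (2 ^ Q) (2 ^ R)) fun t j => X (t, j) ω} := by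
  have hP := h.isProbabilityMeasure
  set D := ⌈max (2 * badnessBound) 1⌉₊ with hD
  have hDle : max (2 * badnessBound) 1 ≤ D := Nat.le_ceil _
  have hD1 : (1 : ℝ) ≤ D := (le_max_right _ _).trans hDle
  have hD0 : (0 : ℝ) < D := by linarith
  set δ : ℝ := Real.exp (-(D + 1)) ^ 3 / ((D : ℝ) ^ 97 * (D + 2) ^ 3) with hδ
  have hδ0 : 0 < δ := by positivity
  refine ⟨ENNReal.ofReal δ * (1 / 2), ?_, fun Q => ?_⟩
  · exact ENNReal.mul_pos (by simpa using hδ0) (by simp)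
  obtain ⟨R, hQR, hR⟩ := exists_two_pow_mul_decayRate_le_one Q
  have hMpos : 0 < 2 ^ R := by positivity
  refine ⟨R + (D + 2), by omega, ?_⟩
  set I := Finset.Ioc ((2 : ℕ) ^ Q) (2 ^ R) with hI
  set J := Finset.Ioc ((2 : ℕ) ^ R) ((D + 2) * 2 ^ R) with hJ
  set A : Finset (Fin 3 × ℕ) := Finset.univ ×ˢ I with hA
  set B : Finset (Fin 3 × ℕ) := Finset.univ ×ˢ J with hB
  have hIJ : Disjoint I J := by
    rw [Finset.disjoint_left]
    intro j hj hj'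
    have := (Finset.mem_Ioc.1 hj).2
    have := (Finset.mem_Ioc.1 hj').1
    omega
  have hAB : Disjoint A B := by
    rw [Finset.disjoint_left]
    intro p hp hp'
    exact Finset.disjoint_left.1 hIJ (Finset.mem_product.1 hp).2 (Finset.mem_product.1 hp').2
  have hIK : I ∪ J ⊆ Finset.Ioc (2 ^ Q) (2 ^ (R + (D + 2))) := by
    have h1 : 2 ^ Q ≤ 2 ^ R := Nat.pow_le_pow_right two_pos hQR.le
    have h2 : (D + 2) * 2 ^ R ≤ 2 ^ (R + (D + 2)) := by
      rw [pow_add, mul_comm]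
      exact Nat.mul_le_mul_left _ (Nat.lt_two_pow_self).le
    have h3 : 2 ^ R ≤ (D + 2) * 2 ^ R := Nat.le_mul_of_pos_left _ (by omega)
    intro j hj
    rw [Finset.mem_Ioc]
    rcases Finset.mem_union.1 hj with hj | hj <;> have := Finset.mem_Ioc.1 hj <;>
      constructor <;> omega
  -- Quantifying over extensions `c` turns conditions on full count functions into conditions on the
  -- coordinates in `A`, as independence requires.
  set S : Set (A → ℕ) := {u | ∃ c : Fin 3 → ℕ → ℕ, (∀ p : A, c p.1.1 p.1.2 = u p) ∧
    badness Q R c ≤ D} with hS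
  set H : (A → ℕ) → Set (B → ℕ) := fun u => {v | ∃ c : Fin 3 → ℕ → ℕ,
    (∀ p : A, c p.1.1 p.1.2 = u p) ∧ ∃ x : Fin 3 → ℕ, (∀ t, ∃ hx : (t, x t) ∈ B, 1 ≤ v ⟨_, hx⟩) ∧
      ∃ (s : Fin 3 → ℕ) (w : ℕ), ∀ t, IsSubsum I (c t) (s t) ∧ x t + s t = w} with hH
  have key : ∀ u ∈ S, ENNReal.ofReal δ ≤ P ((fun ω (p : B) => X p ω) ⁻¹' H u) := by
    rintro u ⟨c, hc, hbad⟩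
    have b1 := fun t => sparsity_nonneg Q R (c t)
    have b2 := fun t => expTotal_nonneg Q R (c t)
    have b3 := energyBound_nonneg Q R c
    have b4 := Finset.sum_nonneg fun t (_ : t ∈ Finset.univ) => b1 t
    have b5 := Finset.sum_nonneg fun t (_ : t ∈ Finset.univ) => b2 t
    rw [badness] at hbad
    obtain ⟨T, hT, hcard⟩ := exists_completing_triples (D := D) hQR.le (c := c)
      (fun t => by
        have := Finset.single_le_sum (fun t _ => b1 t) (Finset.mem_univ t)
        linarith) (by linarith)
      (fun t => by
        have := Finset.single_le_sum (fun t _ => b2 t) (Finset.mem_univ t)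
        linarith)
    have h1 := h.measure_exists_mem_le hMpos fun x hx t => (hT x hx).1 t
    refine le_trans (ENNReal.ofReal_le_ofReal ?_) (h1.trans (measure_mono ?_))
    · have hM0 : (0 : ℝ) < ((2 ^ R : ℕ) : ℝ) := by exact_mod_cast hMpos
      rw [hδ, div_pow, mul_div_assoc', div_le_div_iff₀ (by positivity) (by positivity), mul_pow]
      have h5 : 0 ≤ Real.exp (-(D + 1 : ℝ)) ^ 3 * ((D : ℝ) + 2) ^ 3 := by positivity
      calc _ = (Real.exp (-(D + 1 : ℝ)) ^ 3 * ((D : ℝ) + 2) ^ 3) * ((2 ^ R : ℕ) : ℝ) ^ 3 := by ring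
        _ ≤ (Real.exp (-(D + 1 : ℝ)) ^ 3 * ((D : ℝ) + 2) ^ 3) * (T.card * (D : ℝ) ^ 97) :=
          mul_le_mul_of_nonneg_left hcard h5
        _ = _ := by ring
    · rintro ω ⟨x, hx, hω⟩
      obtain ⟨hxJ, s, w, hsw⟩ := hT x hx
      exact ⟨c, hc, x, fun t => ⟨Finset.mem_product.2 ⟨Finset.mem_univ _, hxJ t⟩, hω t⟩, s, w, hsw⟩
  have hind := (h.indepFun_of_disjoint hAB).mul_measure_le_measure
    (measurable_pi_lambda _ fun p => h.measurable p) (measurable_pi_lambda _ fun p => h.measurable p) key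
  have hhalf : 1 / 2 ≤ P ((fun ω (p : A) => X p ω) ⁻¹' S) := by
    refine (h.measure_badness_le hR hD0 ((le_max_left _ _).trans hDle)).trans (measure_mono ?_)
    intro ω hω
    exact ⟨fun t j => X (t, j) ω, fun p => rfl, hω⟩
  refine (mul_le_mul_right hhalf _).trans (hind.trans (measure_mono ?_))
  rintro ω ⟨-, c, hc, x, hx, s, w, hsw⟩
  refine ⟨w, ?_, fun t => ?_⟩
  · obtain ⟨hx0, -⟩ := hx 0
    have := (Finset.mem_Ioc.1 (Finset.mem_product.1 hx0).2).1
    have := (hsw 0).2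
    omega
  · obtain ⟨hxt, hXt⟩ := hx t
    have h1 : IsSubsum I (fun j => X (t, j) ω) (s t) := (hsw t).1.congr fun j hj =>
      hc ⟨(t, j), Finset.mem_product.2 ⟨Finset.mem_univ _, hj⟩⟩
    have h2 : IsSubsum J (fun j => X (t, j) ω) (x t) :=
      (isSubsum_singleton (c := fun j => X (t, j) ω) hXt).mono
        (Finset.singleton_subset_iff.2 (Finset.mem_product.1 hxt).2)
    have h3 := (h1.union h2 hIJ).mono hIK
    rwa [add_comm (s t), (hsw t).2] at h3

theorem measurableSet_hasCommonSubsum (I : Finset ℕ) :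
    MeasurableSet {ω | HasCommonSubsum I fun t j => X (t, j) ω} := by
  have := h.measurable_comp_of_dependsOn (A := Finset.univ ×ˢ I)
    (f := fun c => HasCommonSubsum I fun t j => c (t, j)) fun c d hcd => by
      have hcd' : ∀ t, ∀ j ∈ I, c (t, j) = d (t, j) := fun t j hj => hcd _ (by simpa using hj)
      exact propext ⟨fun hc => hc.congr hcd', fun hd => hd.congr fun t j hj => (hcd' t j hj).symm⟩
  exact measurableSet_setOfPred.2 this

theorem measure_not_hasCommonSubsum_le {I J : Finset ℕ} (hIJ : Disjoint I J) :
    P {ω | ¬ HasCommonSubsum (I ∪ J) fun t j => X (t, j) ω} ≤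
      P {ω | ¬ HasCommonSubsum I fun t j => X (t, j) ω} *
        P {ω | ¬ HasCommonSubsum J fun t j => X (t, j) ω} := by
  classical
  have hAB : Disjoint ((Finset.univ : Finset (Fin 3)) ×ˢ I) (Finset.univ ×ˢ J) := by
    rw [Finset.disjoint_left]
    intro p hp hp'
    exact Finset.disjoint_left.1 hIJ (Finset.mem_product.1 hp).2 (Finset.mem_product.1 hp').2
  have hpre : ∀ K : Finset ℕ, {ω | ¬ HasCommonSubsum K fun t j => X (t, j) ω} =
      (fun ω (p : ((Finset.univ : Finset (Fin 3)) ×ˢ K : Finset _)) => X p ω) ⁻¹'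
        {u | ∀ c : Fin 3 → ℕ → ℕ, (∀ p, c p.1.1 p.1.2 = u p) → ¬ HasCommonSubsum K c} := by
    intro K
    ext ω
    constructor
    · intro hω c hc hcom
      exact hω (hcom.congr fun t j hj => hc ⟨(t, j), Finset.mem_product.2 ⟨Finset.mem_univ _, hj⟩⟩)
    · intro hω
      exact hω (fun t j => X (t, j) ω) fun p => rfl
  have hind := (h.indepFun_of_disjoint hAB).measure_inter_preimage_eq_mul
    {u | ∀ c : Fin 3 → ℕ → ℕ, (∀ p, c p.1.1 p.1.2 = u p) → ¬ HasCommonSubsum I c}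
    {u | ∀ c : Fin 3 → ℕ → ℕ, (∀ p, c p.1.1 p.1.2 = u p) → ¬ HasCommonSubsum J c}
    (Set.to_countable _).measurableSet (Set.to_countable _).measurableSet
  rw [← hpre I, ← hpre J] at hind
  rw [← hind]
  exact measure_mono fun ω hω => ⟨fun hc => hω (hc.mono Finset.subset_union_left),
    fun hc => hω (hc.mono Finset.subset_union_right)⟩

/-- Each new block starts where the previous one ended and multiplies the failure probability by at
most `1 - δ`. -/
theorem exists_measure_hasCommonSubsum_gt {ε : ℝ} (hε : 0 < ε) :
    ∃ N : ℕ, ENNReal.ofReal (1 - ε) ≤ P {ω | HasCommonSubsum (Finset.Icc 1 N) fun t j => X (t, j) ω} := by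
  have hP := h.isProbabilityMeasure
  obtain ⟨δ, hδ, hblock⟩ := h.exists_measure_hasCommonSubsum_ge
  have hcompl : ∀ I, P {ω | ¬ HasCommonSubsum I fun t j => X (t, j) ω} =
      1 - P {ω | HasCommonSubsum I fun t j => X (t, j) ω} := fun I =>
    prob_compl_eq_one_sub (h.measurableSet_hasCommonSubsum I)
  have hiter : ∀ m : ℕ, ∃ R, P {ω | ¬ HasCommonSubsum (Finset.Ioc 1 (2 ^ R)) fun t j => X (t, j) ω} ≤
      (1 - δ) ^ m := by
    intro m
    induction m with
    | zero => exact ⟨0, by simpa using prob_le_one⟩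
    | succ m ih =>
      obtain ⟨Q, hQ⟩ := ih
      obtain ⟨R, hQR, hR⟩ := hblock Q
      refine ⟨R, ?_⟩
      have hle : (2 : ℕ) ^ Q ≤ 2 ^ R := Nat.pow_le_pow_right two_pos hQR.le
      have hu := Finset.Ioc_union_Ioc_eq_Ioc (a := 1) (b := 2 ^ Q) (c := 2 ^ R) Nat.one_le_two_pow hle
      have hd : Disjoint (Finset.Ioc 1 (2 ^ Q)) (Finset.Ioc (2 ^ Q) (2 ^ R)) :=
        Finset.Ioc_disjoint_Ioc_of_le le_rfl
      rw [← hu, pow_succ]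
      refine (h.measure_not_hasCommonSubsum_le hd).trans (mul_le_mul' hQ ?_)
      rw [hcompl]
      exact tsub_le_tsub_left hR 1
  have hlt : 1 - δ < 1 := ENNReal.sub_lt_self ENNReal.one_ne_top one_ne_zero hδ.ne'
  have htend := ENNReal.tendsto_pow_atTop_nhds_zero_of_lt_one hlt
  obtain ⟨m, hm⟩ := (htend.eventually (gt_mem_nhds (ENNReal.ofReal_pos.2 hε))).exists
  obtain ⟨R, hR⟩ := hiter m
  refine ⟨2 ^ R, ?_⟩
  have hmono : P {ω | HasCommonSubsum (Finset.Ioc 1 (2 ^ R)) fun t j => X (t, j) ω} ≤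
      P {ω | HasCommonSubsum (Finset.Icc 1 (2 ^ R)) fun t j => X (t, j) ω} :=
    measure_mono fun ω hω => hω.mono Finset.Ioc_subset_Icc_self
  refine le_trans ?_ hmono
  have h1 := hR.trans hm.le
  rw [hcompl, tsub_le_iff_left] at h1
  rw [ENNReal.ofReal_sub _ hε.le, ENNReal.ofReal_one, tsub_le_iff_right]
  exact h1

end IsPoissonFamily

/-! ### Transfer to random permutations -/

theorem IsSubsum.le_sum {I : Finset ℕ} {c : ℕ → ℕ} {s : ℕ} (h : IsSubsum I c s) :
    s ≤ ∑ j ∈ I, j * c j := by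
  obtain ⟨m, hm, rfl⟩ := h
  exact Finset.sum_le_sum fun j hj => Nat.mul_le_mul_left j (hm j hj)

theorem IsSubsum.hasFixedSetOfSize {n : ℕ} {π : Equiv.Perm (Fin n)} {I : Finset ℕ} {s : ℕ}
    (h : IsSubsum I (fun j => π.partition.parts.count j) s) : HasFixedSetOfSize π s := by
  obtain ⟨m, hm, rfl⟩ := h
  have hT : ∑ j ∈ I, Multiset.replicate (m j) j ≤ π.partition.parts := by
    rw [Multiset.le_iff_count]
    intro j
    rw [Multiset.count_sum']
    simp only [Multiset.count_replicate, Finset.sum_ite_eq']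
    split_ifs with hj
    · exact hm j hj
    · exact Nat.zero_le _
  obtain ⟨S, hS, hS'⟩ := π.exists_invariant_card_eq_sum hT
  refine ⟨S, ?_, hS'⟩
  rw [hS, Multiset.sum_sum]
  exact Finset.sum_congr rfl fun j _ => by rw [Multiset.sum_replicate, smul_eq_mul, mul_comm]

theorem tendsto_uniformProb_forall_count_eq (N : ℕ) (c : Fin 3 → ℕ → ℕ) :
    Tendsto (fun n => uniformProb {π : Fin 3 → Equiv.Perm (Fin n) |
      ∀ t, ∀ j ∈ Finset.Icc 1 N, (π t).partition.parts.count j = c t j}) atTop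
      (𝓝 (∏ t, ∏ j ∈ Finset.Icc 1 N, (Real.exp (-(1 / j : ℝ)) * cycleWeight j (c t j)))) := by
  have h : ∀ n, uniformProb {π : Fin 3 → Equiv.Perm (Fin n) |
      ∀ t, ∀ j ∈ Finset.Icc 1 N, (π t).partition.parts.count j = c t j} =
      ∏ t, uniformProb {π : Equiv.Perm (Fin n) |
        ∀ j ∈ Finset.Icc 1 N, π.partition.parts.count j = c t j} := fun n =>
    uniformProb_pi fun t => {π : Equiv.Perm (Fin n) |
        ∀ j ∈ Finset.Icc 1 N, π.partition.parts.count j = c t j}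
  simp only [h]
  exact tendsto_finsetProd _ fun t _ => tendsto_uniformProb_count_eq N (c t)

open MeasureTheory in
theorem exists_finset_lt_sum_measure {α : Type*} [MeasurableSpace α] [Countable α]
    [MeasurableSingletonClass α] (μ : Measure α) (S : Set α) {x : ENNReal} (hx : x < μ S) :
    ∃ F : Finset α, (∀ a ∈ F, a ∈ S) ∧ x < ∑ a ∈ F, μ {a} := by
  classical
  rw [← Measure.tsum_indicator_apply_singleton μ S S.to_countable.measurableSet,
    ENNReal.tsum_eq_iSup_sum, lt_iSup_iff] at hx
  obtain ⟨F, hF⟩ := hx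
  refine ⟨F.filter (· ∈ S), fun a ha => (Finset.mem_filter.1 ha).2, ?_⟩
  rw [Finset.sum_filter]
  simpa only [Set.indicator_apply] using hF

/-- Restricted to lengths up to `N`, the counts take countably many values, so finitely many good
ones carry almost all the mass. For finitely many values, pointwise convergence of probabilities is
enough for the transfer. -/
theorem exists_finset_good_counts {ε : ℝ} (hε : 0 < ε) (hε1 : ε < 1) :
    ∃ (N : ℕ) (F : Finset (((Finset.univ : Finset (Fin 3)) ×ˢ Finset.Icc 1 N : Finset _) → ℕ))
      (c : (((Finset.univ : Finset (Fin 3)) ×ˢ Finset.Icc 1 N : Finset _) → ℕ) → Fin 3 → ℕ → ℕ),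
      (∀ u p, c u p.1.1 p.1.2 = u p) ∧
      (∀ u ∈ F, HasCommonSubsum (Finset.Icc 1 N) (c u)) ∧
      1 - ε < ∑ u ∈ F, ∏ t, ∏ j ∈ Finset.Icc 1 N,
        (Real.exp (-(1 / j : ℝ)) * cycleWeight j (c u t j)) := by
  classical
  have h := IsPoissonFamily.infinitePi (Fin 3)
  obtain ⟨N, hN⟩ := h.exists_measure_hasCommonSubsum_gt (half_pos hε)
  set P := MeasureTheory.Measure.infinitePi fun p : Fin 3 × ℕ =>
    ProbabilityTheory.poissonMeasure (1 / (p.2 : NNReal)) with hP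
  set A : Finset (Fin 3 × ℕ) := Finset.univ ×ˢ Finset.Icc 1 N with hA
  set c : (A → ℕ) → Fin 3 → ℕ → ℕ := fun u t j => if hp : (t, j) ∈ A then u ⟨(t, j), hp⟩ else 0 with hc
  have hcu : ∀ u (p : A), c u p.1.1 p.1.2 = u p := fun u p => by simp [hc, p.2]
  have hmeas : Measurable fun (ω : Fin 3 × ℕ → ℕ) (p : A) => ω p :=
    measurable_pi_lambda _ fun p => measurable_pi_apply _
  have hlt : ENNReal.ofReal (1 - ε) <
      (P.map fun (ω : Fin 3 × ℕ → ℕ) (p : A) => ω p) {u | HasCommonSubsum (Finset.Icc 1 N) (c u)} := by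
    rw [MeasureTheory.Measure.map_apply hmeas (Set.to_countable _).measurableSet]
    refine lt_of_lt_of_le ?_ (hN.trans (MeasureTheory.measure_mono fun ω hω => ?_))
    · rw [ENNReal.ofReal_lt_ofReal_iff] <;> linarith
    · exact hω.congr fun t j hj =>
        (hcu (fun p : A => ω p) ⟨(t, j), Finset.mem_product.2 ⟨Finset.mem_univ _, hj⟩⟩).symm
  obtain ⟨F, hF, hsum⟩ := exists_finset_lt_sum_measure _ _ hlt
  refine ⟨N, F, c, hcu, hF, ?_⟩
  have hpt : ∀ u : A → ℕ, (P.map fun (ω : Fin 3 × ℕ → ℕ) (p : A) => ω p) {u} =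
      ENNReal.ofReal (∏ t, ∏ j ∈ Finset.Icc 1 N,
        (Real.exp (-(1 / j : ℝ)) * cycleWeight j (c u t j))) := by
    intro u
    have h1 := h.measure_forall_eq A fun p => c u p.1 p.2
    rw [hA, Finset.prod_product] at h1
    rw [MeasureTheory.Measure.map_apply hmeas (measurableSet_singleton u), ← h1]
    congr 1
    ext ω
    simp only [Set.mem_preimage, Set.mem_singleton_iff, funext_iff, Set.mem_ofPred_eq]
    exact ⟨fun hω p hp => (hω ⟨p, hp⟩).trans (hcu u ⟨p, hp⟩).symm, fun hω p => by rw [hω p p.2, hcu]⟩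
  simp only [hpt] at hsum
  have hnn : ∀ u : A → ℕ, 0 ≤ ∏ t, ∏ j ∈ Finset.Icc 1 N,
        (Real.exp (-(1 / j : ℝ)) * cycleWeight j (c u t j)) := fun u =>
    Finset.prod_nonneg fun t _ => Finset.prod_nonneg fun j _ =>
      mul_nonneg (Real.exp_pos _).le (cycleWeight_nonneg _ _)
  rw [← ENNReal.ofReal_sum_of_nonneg fun u _ => hnn u] at hsum
  exact (ENNReal.ofReal_lt_ofReal_iff_of_nonneg (by linarith)).1 hsum

theorem exists_bound_uniformProb_ge {ε : ℝ} (hε : 0 < ε) :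
    ∃ k₀ n₀ : ℕ, ∀ n : ℕ, n₀ ≤ n → 1 - ε ≤ uniformProb {π : Fin 3 → Equiv.Perm (Fin n) |
      ∃ k : ℕ, 0 < k ∧ k < n ∧ k ≤ k₀ ∧ ∀ i, HasFixedSetOfSize (π i) k} := by
  classical
  rcases le_or_gt 1 ε with hε1 | hε1
  · exact ⟨0, 0, fun n _ => (sub_nonpos.2 hε1).trans (uniformProb_nonneg _)⟩
  obtain ⟨N, F, c, hc, hF, hlt⟩ := exists_finset_good_counts hε hε1
  -- A common subset sum is at most the total size for `t = 0`; summing over `F` bounds all cases at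
  -- once, and `n ≥ k₀ + 1` gives `k < n`.
  set k₀ := ∑ u ∈ F, ∑ j ∈ Finset.Icc 1 N, j * c u 0 j with hk₀
  have hlim := tendsto_finsetSum F fun u _ => tendsto_uniformProb_forall_count_eq N (c u)
  obtain ⟨n₁, hn₁⟩ := eventually_atTop.1 (hlim.eventually (lt_mem_nhds hlt))
  refine ⟨k₀, max n₁ (k₀ + 1), fun n hn => ?_⟩
  refine (hn₁ n ((le_max_left _ _).trans hn)).le.trans ?_
  refine sum_uniformProb_le_of_pairwiseDisjoint ?_ ?_
  · intro u _ v _ huv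
    rw [Function.onFun, Set.disjoint_left]
    intro π hu hv
    apply huv
    funext p
    have hp := (Finset.mem_product.1 p.2).2
    rw [← hc u p, ← hc v p, ← hu _ _ hp, ← hv _ _ hp]
  · intro u hu π hπ
    obtain ⟨k, hk, hsub⟩ := hF u hu
    have hkk : k ≤ k₀ := (hsub 0).le_sum.trans
      (Finset.single_le_sum (f := fun u => ∑ j ∈ Finset.Icc 1 N, j * c u 0 j)
        (fun _ _ => Nat.zero_le _) hu)
    have hkn : k₀ + 1 ≤ n := (le_max_right _ _).trans hn
    refine ⟨k, hk, by omega, hkk, fun t => ?_⟩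
    exact ((hsub t).congr fun j hj => (hπ t j hj).symm).hasFixedSetOfSize

theorem tendsto_uniformProb_exists_hasFixedSetOfSize :
    Tendsto (fun n : ℕ => uniformProb {π : Fin 3 → Equiv.Perm (Fin n) |
      ∃ k : ℕ, 0 < k ∧ k < n ∧ ∀ i, HasFixedSetOfSize (π i) k}) atTop (𝓝 1) := by
  refine tendsto_order.2 ⟨fun a ha => ?_, fun a ha => Eventually.of_forall fun n =>
    (uniformProb_le_one _).trans_lt ha⟩
  obtain ⟨k₀, n₀, hn⟩ := exists_bound_uniformProb_ge (half_pos (sub_pos.2 ha))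
  filter_upwards [eventually_ge_atTop n₀] with n hn₀
  have h1 := hn n hn₀
  have h2 : uniformProb {π : Fin 3 → Equiv.Perm (Fin n) |
      ∃ k : ℕ, 0 < k ∧ k < n ∧ k ≤ k₀ ∧ ∀ i, HasFixedSetOfSize (π i) k} ≤
      uniformProb {π : Fin 3 → Equiv.Perm (Fin n) |
      ∃ k : ℕ, 0 < k ∧ k < n ∧ ∀ i, HasFixedSetOfSize (π i) k} :=
    uniformProb_mono fun π ⟨k, h0, hk, _, h⟩ => ⟨k, h0, hk, h⟩
  linarith

theorem tendsto_uniformProb_invariably_generatesTransitive :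
    Tendsto (fun n : ℕ => uniformProb
        {π : Fin 3 → Equiv.Perm (Fin n) | Invariably GeneratesTransitive π}) atTop (𝓝 0) := by
  have h : ∀ n : ℕ, uniformProb {π : Fin 3 → Equiv.Perm (Fin n) | Invariably GeneratesTransitive π} =
      1 - uniformProb {π : Fin 3 → Equiv.Perm (Fin n) |
        ∃ k : ℕ, 0 < k ∧ k < n ∧ ∀ i, HasFixedSetOfSize (π i) k} := by
    intro n
    rw [← uniformProb_compl]
    congr 1
    ext π
    rw [Set.mem_compl_iff, Set.mem_ofPred_eq, Set.mem_ofPred_eq,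
      ← not_invariably_generatesTransitive_iff, not_not]
  simp only [h]
  simpa using tendsto_uniformProb_exists_hasFixedSetOfSize.const_sub 1

theorem theorem1p2 :
    -- the probability of invariably generating a transitive subgroup tends to zero
    Tendsto (fun n : ℕ => uniformProb
        {π : Fin 3 → Equiv.Perm (Fin n) | Invariably GeneratesTransitive π}) atTop (𝓝 0) ∧
    -- in particular, so does the probability of invariably generating the symmetric group
    Tendsto (fun n : ℕ => uniformProb
        {π : Fin 3 → Equiv.Perm (Fin n) | Invariably GeneratesSym π}) atTop (𝓝 0) ∧
    -- with probability tending to one there is a common size of proper nonempty fixed sets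
    Tendsto (fun n : ℕ => uniformProb
        {π : Fin 3 → Equiv.Perm (Fin n) |
          ∃ k : ℕ, 0 < k ∧ k < n ∧ ∀ i, HasFixedSetOfSize (π i) k}) atTop (𝓝 1) ∧
    -- the first and third events are complementary
    (∀ (n : ℕ) (π : Fin 3 → Equiv.Perm (Fin n)),
        ¬ Invariably GeneratesTransitive π ↔
          ∃ k : ℕ, 0 < k ∧ k < n ∧ ∀ i, HasFixedSetOfSize (π i) k) ∧
    -- the sharper form with a bounded common size
    (∀ ε : ℝ, 0 < ε → ∃ k₀ n₀ : ℕ, ∀ n : ℕ, n₀ ≤ n →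
        1 - ε ≤ uniformProb
          {π : Fin 3 → Equiv.Perm (Fin n) |
            ∃ k : ℕ, 0 < k ∧ k < n ∧ k ≤ k₀ ∧ ∀ i, HasFixedSetOfSize (π i) k}) := by
  refine ⟨tendsto_uniformProb_invariably_generatesTransitive, ?_,
    tendsto_uniformProb_exists_hasFixedSetOfSize,
    fun n π => not_invariably_generatesTransitive_iff π, fun ε hε => exists_bound_uniformProb_ge hε⟩
  refine squeeze_zero (fun _ => uniformProb_nonneg _) (fun n => uniformProb_mono ?_)
    tendsto_uniformProb_invariably_generatesTransitive
  exact fun π hπ => hπ.mono fun _ => GeneratesSym.generatesTransitive
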